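/- Fix countably infinite sets of individual names, concept names and role names, where the role names are partitioned into three countably infinite sets of call, internal and return names. An interpretation $\mathcal I$ has a non-empty domain $\Delta$ and maps individual names to elements of $\Delta$, concept names $A$ to sets $A^{\mathcal I}\subseteq\Delta$ and role names $r$ to relations $r^{\mathcal I}\subseteq\Delta\times\Delta$. Concepts of $\mathcal{ALC}^{\mathsf{Self}}_{\mathsf{vpl}}$ are given by $$C,D ::= \top \mid A \mid \neg C \mid C\sqcap D \mid \exists r.C \mid \exists r.\mathsf{Self} \mid \exists \mathcal A.C ,$$ where $\mathcal A$ is a nondeterministic visibly pushdown automaton over a finite set of letters; the letters are the role names (call, internal or return) and, as internal letters, the tests $A?$ for concept names $A$. The Boolean constructors and $\exists r.C$ have their usual semantics, $d\in(\exists r.\mathsf{Self})^{\mathcal I}$ iff $(d,d)\in r^{\mathcal I}$, and $d\in(\exists\mathcal A.C)^{\mathcal I}$ iff some word $w_1\cdots w_n\in L(\mathcal A)$ and some $\rho_1,\dots,\rho_{n+1}\in\Delta$ satisfy $\rho_1=d$, $\rho_{n+1}\in C^{\mathcal I}$ and, for each $j\le n$, either $w_j$ is a role name and $(\rho_j,\rho_{j+1})\in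 w_j^{\mathcal I}$, or $w_j=A?$, $\rho_j=\rho_{j+1}$ and $\rho_j\in A^{\mathcal I}$. A concept $C$ is satisfiable if $C^{\mathcal I}\neq\emptyset$ for some interpretation $\mathcal I$. A deterministic one-counter automaton (DOCA) is a deterministic pushdown automaton (silent moves allowed, acceptance by final state) with a single stack symbol besides the bottom marker. Let $\Sigma$ be a finite set of letters, let the pairs in $\Sigma\times\{c,i,r\}$ be (distinct) call, internal and return role names, respectively, and let $\mathtt x$ be a further internal role name. A visibly pushdown language $M$ is an encoding of a language $L\subseteq\Sigma^*$ with separator $\mathtt x$ if every word of $M$ has the form $\tilde a_1\mathtt x\tilde a_2\mathtt x\cdots\mathtt x\tilde a_n$ with $\tilde a_1,\dots,\tilde a_n\in\Sigma\times\{c,i,r\}$, and $L$ is the set of the words $\pi_1(\tilde a_1)\cdots\pi_1(\tilde a_n)$ for which $\tilde a_1\mathtt x\cdots\mathtt x\tilde a_n\in M$. **Theorem.** The satisfiability problem for $\mathcal{ALC}^{\mathsf{Self}}_{\mathsf{vpl}}$-concepts is undecidable. It remains undecidable when only concepts are allowed in which every automaton accepts an encoding of a DOCA language (with one alphabet $\Sigma$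 and one separator $\mathtt x$ for all automata of the concept): there is no algorithm that decides satisfiability correctly for all such concepts. -/

import Mathlib

namespace ALCSelfVPL

/-! ## Names and letters

Individual names and concept names are natural numbers. Role names come partitioned into call,
internal and return names, each part being countably infinite. -/

abbrev IndividualName := ℕ

abbrev ConceptName := ℕ

inductive RoleName : Type
  | call (a : ℕ)
  | internal (a : ℕ)
  | ret (a : ℕ)

/-- The alphabet of path expressions: role names, and tests `A?` for concept names `A`.
Call (return) letters are the call (return) role names; every other letter is internal. -/
inductive Letter : Type
  | role (r : RoleName)
  | test (A : ConceptName)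

/-! ## Visibly pushdown automata -/

/-- A nondeterministic visibly pushdown automaton over a finite part of the pushdown alphabet,
given as finite data. States and non-bottom stack symbols are natural numbers; the finite sets of
states, stack symbols and letters are those mentioned. Call, internal and return letters are
represented by `a` (for the role name `call a`), by `inl a` or `inr A` (for the role name
`internal a` or the test `A?`), and by `a` (for the role name `ret a`), respectively.
* `(q, a, q', γ) ∈ calls`: read a call letter in state `q`, go to `q'`, push `γ`;
* `(q, b, q') ∈ internals`: read an internal letter in state `q`, go to `q'`;
* `(q, a, some γ, q') ∈ returns`: read a return letter in state `q`, pop `γ`, go to `q'`;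
* `(q, a, none, q') ∈ returns`: the same with the bottom-of-stack symbol, which is not removed. -/
structure VPA : Type where
  initial : List ℕ
  final : List ℕ
  calls : List (ℕ × ℕ × ℕ × ℕ)
  internals : List (ℕ × (ℕ ⊕ ConceptName) × ℕ)
  returns : List (ℕ × ℕ × Option ℕ × ℕ)

namespace VPA

/-- `A.Step a (q, σ) (q', σ')`: the configuration `(q', σ')` is an `a`-successor of `(q, σ)`.
A stack content is listed from the top, without the bottom-of-stack symbol. -/
def Step (A : VPA) : Letter → ℕ × List ℕ → ℕ × List ℕ → Prop
  | .role (.call a), (q, σ), (q', σ') => ∃ γ, (q, a, q', γ) ∈ A.calls ∧ σ' = γ :: σ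
  | .role (.internal a), (q, σ), (q', σ') => (q, Sum.inl a, q') ∈ A.internals ∧ σ' = σ
  | .test B, (q, σ), (q', σ') => (q, Sum.inr B, q') ∈ A.internals ∧ σ' = σ
  | .role (.ret a), (q, σ), (q', σ') =>
      (∃ γ, σ = γ :: σ' ∧ (q, a, some γ, q') ∈ A.returns) ∨
        (σ = [] ∧ σ' = [] ∧ (q, a, none, q') ∈ A.returns)

/-- There is a sequence of steps labelled by the given word between two configurations. -/
def Run (A : VPA) : List Letter → ℕ × List ℕ → ℕ × List ℕ → Prop
  | [], c, c' => c = c'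
  | a :: w, c, c' => ∃ c₁, A.Step a c c₁ ∧ A.Run w c₁ c'

/-- The language accepted by a visibly pushdown automaton. -/
def language (A : VPA) : Language Letter :=
  {w | ∃ q ∈ A.initial, ∃ q' ∈ A.final, ∃ σ, A.Run w (q, []) (q', σ)}

end VPA

/-! ## Concepts and their semantics -/

/-- Concepts of `ALC` with visibly pushdown path expressions and the `Self` operator. -/
inductive Concept : Type
  | top
  | name (A : ConceptName)
  | existsSelf (r : RoleName)
  | neg (C : Concept)
  | inter (C D : Concept)
  | existsRole (r : RoleName) (C : Concept)
  | existsPath (A : VPA) (C : Concept)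

/-- An interpretation with domain `Δ`. -/
structure Interpretation (Δ : Type) where
  individual : IndividualName → Δ
  concept : ConceptName → Set Δ
  role : RoleName → Set (Δ × Δ)

namespace Interpretation

variable {Δ : Type}

/-- One step of a path, labelled by a letter. -/
def LetterStep (I : Interpretation Δ) : Letter → Δ → Δ → Prop
  | .role r, d, e => (d, e) ∈ I.role r
  | .test A, d, e => d = e ∧ d ∈ I.concept A

/-- There is a path from `d` to `e` labelled by the given word. -/
def WordPath (I : Interpretation Δ) : List Letter → Δ → Δ → Prop
  | [], d, e => d = e
  | a :: w, d, e => ∃ d', I.LetterStep a d d' ∧ I.WordPath w d' e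

/-- `d` `L`-reaches `e`. -/
def Reaches (I : Interpretation Δ) (L : Language Letter) (d e : Δ) : Prop :=
  ∃ w ∈ L, I.WordPath w d e

/-- The extension of a concept. -/
def extension (I : Interpretation Δ) : Concept → Set Δ
  | .top => Set.univ
  | .name A => I.concept A
  | .existsSelf r => {d | (d, d) ∈ I.role r}
  | .neg C => (I.extension C)ᶜ
  | .inter C D => I.extension C ∩ I.extension D
  | .existsRole r C => {d | ∃ e ∈ I.extension C, (d, e) ∈ I.role r}
  | .existsPath A C => {d | ∃ e ∈ I.extension C, I.Reaches A.language d e}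

end Interpretation

/-- A concept is satisfiable if its extension is non-empty in some interpretation
with non-empty domain. -/
def Concept.Satisfiable (C : Concept) : Prop :=
  ∃ (Δ : Type) (_ : Nonempty Δ) (I : Interpretation Δ), (I.extension C).Nonempty

/-- The automata used in a concept. -/
def Concept.automata : Concept → Set VPA
  | .top => ∅
  | .name _ => ∅
  | .existsSelf _ => ∅
  | .neg C => C.automata
  | .inter C D => C.automata ∪ D.automata
  | .existsRole _ C => C.automata
  | .existsPath A C => insert A C.automata

/-! ## Deterministic one-counter automata -/

/-- Actions on a counter. -/
inductive CounterAction : Type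
  | inc
  | keep
  | dec

/-- The effect of an action on a counter, with no result when `0` is to be decremented. -/
def CounterAction.apply : CounterAction → ℕ → Option ℕ
  | .inc, n => some (n + 1)
  | .keep, n => some n
  | .dec, 0 => none
  | .dec, n + 1 => some n

/-- A deterministic one-counter automaton with input alphabet `α` and states `σ`, i.e. a
deterministic pushdown automaton with a single stack symbol besides the bottom marker.
`step q z a` is the transition in state `q`, where `z` tells whether the counter is zero and `a` is
the letter to be read, with `none` standing for the empty word. A transition reading the empty
word excludes all transitions reading a letter in the same situation. -/
structure DOCA (α σ : Type) where
  start : σ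
  accept : Set σ
  step : σ → Bool → Option α → Option (σ × CounterAction)
  deterministic : ∀ q z, (step q z none).isSome → ∀ a, step q z (some a) = none

namespace DOCA

variable {α σ : Type}

/-- `A.Move a c c'`: a transition reading `a` (or nothing, if `a = none`) leads from the
configuration `c` to `c'`, a configuration being a state and a value of the counter. -/
def Move (A : DOCA α σ) (a : Option α) (c c' : σ × ℕ) : Prop :=
  ∃ act, A.step c.1 (c.2 == 0) a = some (c'.1, act) ∧ act.apply c.2 = some c'.2

/-- A computation from one configuration to another that reads the given word. -/
inductive Run (A : DOCA α σ) : List α → σ × ℕ → σ × ℕ → Prop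
  | refl (c : σ × ℕ) : A.Run [] c c
  | silent {c c₁ c' : σ × ℕ} {w : List α} :
      A.Move none c c₁ → A.Run w c₁ c' → A.Run w c c'
  | read {c c₁ c' : σ × ℕ} {a : α} {w : List α} :
      A.Move (some a) c c₁ → A.Run w c₁ c' → A.Run (a :: w) c c'

/-- The language accepted (by final state, from counter value `0`). -/
def language (A : DOCA α σ) : Language α :=
  {w | ∃ q ∈ A.accept, ∃ n, A.Run w (A.start, 0) (q, n)}

end DOCA

/-- `L` is accepted by a deterministic one-counter automaton. -/
def IsDOCALanguage {α : Type} (L : Language α) : Prop :=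
  ∃ (σ : Type) (_ : Finite σ) (A : DOCA α σ), A.language = L

/-! ## Visibly pushdown encodings of languages -/

/-- The three decorations `c`, `i`, `r`. -/
inductive Decoration : Type
  | c
  | i
  | r

/-- The role name that plays the role of the decorated letter. -/
def decorate : ℕ × Decoration → RoleName
  | (a, .c) => .call a
  | (a, .i) => .internal a
  | (a, .r) => .ret a

/-- The word `ã₁ x ã₂ x … x ãₙ` for decorated letters `ã₁, …, ãₙ`, where the separator `x` is the
internal role name with index `x`. -/
def separatedWord {S : Finset ℕ} (x : ℕ) (w : List (S × Decoration)) : List Letter :=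
  ((w.map fun p => decorate (p.1.1, p.2)).intersperse (.internal x)).map .role

/-- `M` is an encoding of the language `L` over `S` with separator `x`: all its words are of the form
`ã₁ x ã₂ x … x ãₙ`, and `L` consists of the projections `a₁ a₂ … aₙ` of these. -/
def Encodes {S : Finset ℕ} (x : ℕ) (M : Language Letter) (L : Language S) : Prop :=
  (∀ u ∈ M, ∃ w : List (S × Decoration), u = separatedWord x w) ∧
    ∀ v : List S, v ∈ L ↔
      ∃ w : List (S × Decoration), separatedWord x w ∈ M ∧ w.map Prod.fst = v

/-- All visibly pushdown languages used in `C` are encodings of languages of deterministic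
one-counter automata, over a common finite alphabet and with a common fresh separator. -/
def Concept.OnlyDOCAEncodings (C : Concept) : Prop :=
  ∃ (S : Finset ℕ) (x : ℕ), x ∉ S ∧ ∀ A ∈ C.automata,
    ∃ L : Language S, IsDOCALanguage L ∧ Encodes x A.language L

/-! ## Effective coding of concepts by natural numbers -/

def roleNameEquiv : RoleName ≃ ℕ ⊕ ℕ ⊕ ℕ where
  toFun
    | .call a => .inl a
    | .internal a => .inr (.inl a)
    | .ret a => .inr (.inr a)
  invFun
    | .inl a => .call a
    | .inr (.inl a) => .internal a
    | .inr (.inr a) => .ret a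
  left_inv r := by cases r <;> rfl
  right_inv s := by rcases s with a | a | a <;> rfl

instance : Denumerable RoleName :=
  Denumerable.ofEquiv _ roleNameEquiv

def vpaEquiv : VPA ≃ List ℕ × List ℕ × List (ℕ × ℕ × ℕ × ℕ) ×
    List (ℕ × (ℕ ⊕ ConceptName) × ℕ) × List (ℕ × ℕ × Option ℕ × ℕ) where
  toFun A := (A.initial, A.final, A.calls, A.internals, A.returns)
  invFun t := ⟨t.1, t.2.1, t.2.2.1, t.2.2.2.1, t.2.2.2.2⟩
  left_inv _ := rfl
  right_inv _ := rfl

instance : Denumerable VPA :=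
  Denumerable.ofEquiv _ vpaEquiv

namespace Concept

open Encodable Denumerable

/-- The Gödel number of a concept. -/
def toCode : Concept → ℕ
  | top => 0
  | name A => 6 * A + 1
  | existsSelf r => 6 * encode r + 2
  | neg C => 6 * C.toCode + 3
  | inter C D => 6 * Nat.pair C.toCode D.toCode + 4
  | existsRole r C => 6 * Nat.pair (encode r) C.toCode + 5
  | existsPath A C => 6 * Nat.pair (encode A) C.toCode + 6

/-- The concept with a given Gödel number. -/
def ofCode : ℕ → Concept
  | 0 => top
  | n + 1 =>
    have h : n / 6 < n + 1 := by omega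
    have h₁ : (n / 6).unpair.1 < n + 1 := (Nat.unpair_left_le _).trans_lt h
    have h₂ : (n / 6).unpair.2 < n + 1 := (Nat.unpair_right_le _).trans_lt h
    match n % 6 with
    | 0 => name (n / 6)
    | 1 => existsSelf (ofNat RoleName (n / 6))
    | 2 => neg (ofCode (n / 6))
    | 3 => inter (ofCode (n / 6).unpair.1) (ofCode (n / 6).unpair.2)
    | 4 => existsRole (ofNat RoleName (n / 6).unpair.1) (ofCode (n / 6).unpair.2)
    | _ => existsPath (ofNat VPA (n / 6).unpair.1) (ofCode (n / 6).unpair.2)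

theorem ofCode_toCode (C : Concept) : ofCode C.toCode = C := by
  have hd : ∀ m k, k < 6 → (6 * m + k) / 6 = m := fun m k hk => by omega
  have hm : ∀ m k, k < 6 → (6 * m + k) % 6 = k := fun m k hk => by omega
  induction C with
  | top => simp [toCode, ofCode]
  | name A => simp [toCode, ofCode]
  | existsSelf r =>
    simp only [toCode, ofCode, hd _ 1 (by norm_num), hm _ 1 (by norm_num), ofNat_encode]
  | neg C ih =>
    simp only [toCode, ofCode, hd _ 2 (by norm_num), hm _ 2 (by norm_num), ih]
  | inter C D ihC ihD =>
    simp only [toCode, ofCode, hd _ 3 (by norm_num), hm _ 3 (by norm_num), Nat.unpair_pair,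
      ihC, ihD]
  | existsRole r C ih =>
    simp only [toCode, ofCode, hd _ 4 (by norm_num), hm _ 4 (by norm_num), Nat.unpair_pair,
      ofNat_encode, ih]
  | existsPath A C ih =>
    simp only [toCode, ofCode, hd _ 5 (by norm_num), hm _ 5 (by norm_num), Nat.unpair_pair,
      ofNat_encode, ih]

theorem toCode_ofCode (n : ℕ) : (ofCode n).toCode = n := by
  induction n using Nat.strong_induction_on with
  | _ n ih =>
    cases n with
    | zero => simp [toCode, ofCode]
    | succ n =>
      have h : n / 6 < n + 1 := by omega
      have e := ih _ h
      have e₁ := ih _ ((Nat.unpair_left_le _).trans_lt h)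
      have e₂ := ih _ ((Nat.unpair_right_le _).trans_lt h)
      have hlt : n % 6 < 6 := Nat.mod_lt _ (by norm_num)
      rw [ofCode]
      generalize hk : n % 6 = k at *
      interval_cases k <;>
        simp only [toCode, encode_ofNat, e, e₁, e₂, Nat.pair_unpair] <;> omega

instance : Denumerable Concept :=
  Denumerable.mk' ⟨toCode, ofCode, ofCode_toCode, toCode_ofCode⟩

end Concept

end ALCSelfVPL

/-! The complement of the halting problem reduces to satisfiability. A partial recursive function is
the domain of termination of a structured counter program, and non-termination on input `n` is
rephrased as the existence of an infinite word over a finite alphabet `S` (`HasRun`,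
`exists_hasRun_iff_not_dom`): neighbouring letters obey a local condition, and each letter
prescribes for every counter an increment, a decrement, a zero test or nothing, all of which must be
defined.

A visibly pushdown automaton can follow one counter on its stack, but one letter may increment a
counter and decrement another, so no fixed division into calls and returns suits all counters.
`Self` removes this obstacle. The concept `hasLetter a` makes the call, internal and return versions
of `a` all reflexive at an element, so the same path can be read under every decoration
(`IsLetterPath.wordPath`), and the automaton of each counter picks the decoration that fits its own
stack. The separator `x` leads from one element to the next.

The concept `runConcept` fixes the initial letters, demands at every element reached by a separated
word a successor with admissible letters, and forbids, for each counter, any path whose word makes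
that counter fail for the first time at its last letter. In a model, dependent choice yields an
infinite path with letters; all its segments are readable, so no counter ever fails
(`hasRun_of_satisfiable`). Conversely, a run gives a model on `ℕ` in which `x` is the successor and
the letter roles are loops at the positions of their letter, so that only the word of the run itself
can be read (`HasRun.satisfiable`).

Each automaton observes a single counter driven by the letters, so it encodes a DOCA language
(`isDOCALanguage_endsLanguage`, `encodes_counterVPA`). This gives the restricted statement, and the
unrestricted one is the case in which the decision procedure is satisfiability itself. -/

namespace ALCSelfVPL

open Function Relation

/-! ## Counter programs -/

/-- Structured programs on counters; `loop k p` is `while k ≠ 0 do (k := k - 1; p)`. -/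
inductive CounterProg : Type
  | skip
  | inc (k : ℕ)
  | seq (p q : CounterProg)
  | loop (k : ℕ) (p : CounterProg)

/-- The contents of all counters. -/
abbrev Store := ℕ → ℕ

namespace CounterProg

/-- `p.Exec s s'`: the program `p` started in `s` terminates in `s'`. -/
def Exec : CounterProg → Store → Store → Prop
  | skip, s, s' => s' = s
  | inc k, s, s' => s' = update s k (s k + 1)
  | seq p q, s, s' => ∃ t, p.Exec s t ∧ q.Exec t s'
  | loop k p, s, s' =>
      ReflTransGen (fun a b => a k ≠ 0 ∧ p.Exec (update a k (a k - 1)) b) s s' ∧ s' k = 0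

theorem exec_seq {p q : CounterProg} {s t s' : Store} (h : ∀ t', p.Exec s t' ↔ t' = t) :
    (seq p q).Exec s s' ↔ q.Exec t s' := by
  simp [Exec, h]

/-- If the body is deterministic along the stores `σ i`, so is the loop: it can stop only at the
first zero of `σ · k`, and diverges if there is none. This form serves unbounded search. -/
theorem exec_loop {k : ℕ} {p : CounterProg} (σ : ℕ → Store)
    (h : ∀ i, σ i k ≠ 0 → ∀ s', p.Exec (update (σ i) k (σ i k - 1)) s' ↔ s' = σ (i + 1))
    (s' : Store) :
    (loop k p).Exec (σ 0) s' ↔ ∃ N, (∀ j < N, σ j k ≠ 0) ∧ σ N k = 0 ∧ s' = σ N := by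
  constructor
  · rintro ⟨hr, h0⟩
    have : ∃ N, (∀ j < N, σ j k ≠ 0) ∧ s' = σ N := by
      clear h0
      induction hr with
      | refl => exact ⟨0, by simp, rfl⟩
      | tail _ hbc ih =>
        obtain ⟨N, hN, rfl⟩ := ih
        refine ⟨N + 1, fun j hj => ?_, (h N hbc.1 _).1 hbc.2⟩
        rcases Nat.lt_succ_iff_lt_or_eq.1 hj with hj | rfl
        · exact hN j hj
        · exact hbc.1
    obtain ⟨N, hN, rfl⟩ := this
    exact ⟨N, hN, h0, rfl⟩
  · rintro ⟨N, hN, h0, rfl⟩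
    refine ⟨?_, h0⟩
    clear h0
    induction N with
    | zero => exact .refl
    | succ N ih =>
      exact (ih fun j hj => hN j (by omega)).tail ⟨hN N (by omega), (h N (hN N (by omega)) _).2 rfl⟩

/-- The bounded case: the body does not touch the loop counter, which therefore counts down from `N`
and stops the loop after exactly `N` rounds. -/
theorem exec_loop_of_eq {k : ℕ} {p : CounterProg} (σ : ℕ → Store) (N : ℕ)
    (hk : ∀ i, σ i k = N - i)
    (h : ∀ i < N, ∀ s', p.Exec (update (σ i) k (N - i - 1)) s' ↔ s' = σ (i + 1)) (s' : Store) :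
    (loop k p).Exec (σ 0) s' ↔ s' = σ N := by
  rw [exec_loop σ]
  · constructor
    · rintro ⟨M, hM, h0, rfl⟩
      rw [hk] at h0
      by_cases hlt : N < M
      · have := hM N hlt
        rw [hk] at this
        omega
      · rw [show M = N by omega]
    · rintro rfl
      refine ⟨N, fun j hj => ?_, ?_, rfl⟩ <;> rw [hk] <;> omega
  · intro i hi s'
    rw [hk] at hi ⊢
    exact h i (by omega) s'

/-- Set a counter to `0`. -/
def clear (k : ℕ) : CounterProg := loop k skip

theorem exec_clear (k : ℕ) (s s' : Store) : (clear k).Exec s s' ↔ s' = update s k 0 := by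
  have := exec_loop_of_eq (k := k) (p := skip) (fun i => update s k (s k - i)) (s k) (by simp)
    (fun i _ s' => by simp [Exec, Nat.sub_sub]) s'
  simpa [clear] using this

/-- Add a counter to another one and set it to `0`. -/
def move (a b : ℕ) : CounterProg := loop a (inc b)

theorem exec_move {a b : ℕ} (hab : a ≠ b) (s s' : Store) :
    (move a b).Exec s s' ↔ s' = update (update s a 0) b (s b + s a) := by
  have := exec_loop_of_eq (k := a) (p := inc b)
    (fun i => update (update s a (s a - i)) b (s b + i)) (s a) (by simp [hab])
    (fun i _ s' => by
      simp only [Exec]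
      apply Eq.congr_right
      funext r
      simp only [update_apply]
      grind) s'
  simpa [move] using this

/-- Copy a counter to another one, using an auxiliary counter, where both are `0` initially. -/
def copy (a b c : ℕ) : CounterProg := seq (loop a (seq (inc b) (inc c))) (move c a)

theorem exec_copy {a b c : ℕ} (hab : a ≠ b) (hac : a ≠ c) (hbc : b ≠ c) {s : Store}
    (hb : s b = 0) (hc : s c = 0) (s' : Store) :
    (copy a b c).Exec s s' ↔ s' = update s b (s a) := by
  have := exec_loop_of_eq (k := a) (p := seq (inc b) (inc c))
    (fun i => update (update (update s a (s a - i)) b i) c i) (s a)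
    (by simp [hab, hac])
    (fun i _ s' => by
      simp only [Exec, exists_eq_left]
      apply Eq.congr_right
      funext r
      simp only [update_apply]
      grind)
  have h0 : (fun i => update (update (update s a (s a - i)) b i) c i) 0 = s := by
    funext r
    simp only [update_apply]
    grind
  beta_reduce at h0 this
  rw [h0] at this
  rw [copy, exec_seq this, exec_move hac.symm]
  apply Eq.congr_right
  funext r
  simp only [update_apply]
  grind

theorem exists_exec_clear_range (b n : ℕ) : ∃ p : CounterProg, ∀ s s' : Store,
    p.Exec s s' ↔ s' = fun r => if b ≤ r ∧ r < b + n then 0 else s r := by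
  induction n with
  | zero =>
    refine ⟨skip, fun s s' => ?_⟩
    simp only [Exec]
    apply Eq.congr_right
    funext r
    grind
  | succ n ih =>
    obtain ⟨p, hp⟩ := ih
    refine ⟨seq p (clear (b + n)), fun s s' => ?_⟩
    rw [exec_seq (hp s), exec_clear]
    apply Eq.congr_right
    funext r
    simp only [update_apply]
    grind

/-! ### Counter programs for all partial recursive functions -/

/-- `Computes f`: for any choice of input counters and an output counter, there is a program that
writes the value of `f` on the contents of the input counters to the output counter, leaving all
other counters unchanged; it may use all counters from some point on, provided they are `0`. -/
def Computes {n : ℕ} (f : List.Vector ℕ n →. ℕ) : Prop :=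
  ∀ (inp : Fin n → ℕ) (out b : ℕ), (∀ i, inp i < b) → out < b → (∀ i, inp i ≠ out) →
    ∃ p : CounterProg, ∀ s : Store, s out = 0 → (∀ r, b ≤ r → s r = 0) → ∀ s',
      p.Exec s s' ↔ ∃ y ∈ f (List.Vector.ofFn fun i => s (inp i)), s' = update s out y

/-- The store with the entries of a vector in the counters from `b` on. -/
def load {n : ℕ} (s : Store) (b : ℕ) (z : List.Vector ℕ n) : Store :=
  fun r => if r < b then s r else z.toList.getD (r - b) 0

theorem load_update_cons {n : ℕ} (s : Store) (b y : ℕ) (z : List.Vector ℕ n) :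
    load (update s b y) (b + 1) z = load s b (y ::ᵥ z) := by
  funext r
  simp only [load, update_apply, List.Vector.toList_cons]
  rcases lt_trichotomy r b with h | rfl | h
  · simp [h, h.ne, Nat.lt_succ_of_lt h]
  · simp
  · obtain ⟨d, rfl⟩ := Nat.exists_eq_add_of_lt h
    simp [show ¬ b + d + 1 < b by omega, show b + d + 1 - (b + 1) = d by omega,
      show b + d + 1 - b = d + 1 by omega]

/-- The functions are evaluated one after another, each into the first free counter; the bound `b`
then grows by one, which protects the value just written, and the inputs below `b` stay intact. -/
theorem exists_exec_load {m n : ℕ} (g : Fin n → List.Vector ℕ m →. ℕ) (hg : ∀ i, Computes (g i))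
    (inp : Fin m → ℕ) (b : ℕ) (hinp : ∀ i, inp i < b) :
    ∃ p : CounterProg, ∀ s : Store, (∀ r, b ≤ r → s r = 0) → ∀ s', p.Exec s s' ↔
      ∃ z ∈ List.Vector.mOfFn fun i => g i (List.Vector.ofFn fun j => s (inp j)),
        s' = load s b z := by
  induction n generalizing b with
  | zero =>
    refine ⟨skip, fun s hs s' => ?_⟩
    have : load s b List.Vector.nil = s := by
      funext r
      simp only [load]
      split_ifs with h
      · rfl
      · simp [hs r (by omega), List.Vector.nil]
    simp [Exec, List.Vector.mOfFn, this]
  | succ n ih =>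
    obtain ⟨p, hp⟩ := hg 0 inp b (b + 1) (fun i => (hinp i).trans (Nat.lt_succ_self b))
      (Nat.lt_succ_self b) (fun i => (hinp i).ne)
    obtain ⟨q, hq⟩ := ih (fun i => g i.succ) (fun i => hg i.succ) (b + 1)
      (fun i => (hinp i).trans (Nat.lt_succ_self b))
    refine ⟨seq p q, fun s hs s' => ?_⟩
    have hu : ∀ y, (fun j => update s b y (inp j)) = fun j => s (inp j) := fun y => by
      funext j
      simp [(hinp j).ne]
    have hq' : ∀ y s', q.Exec (update s b y) s' ↔ _ := fun y s' =>
      hq (update s b y) (fun r hr => by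
        rw [update_apply, if_neg (by omega)]
        exact hs r (by omega)) s'
    simp only [Exec, hp s (hs b le_rfl) fun r hr => hs r (by omega)]
    constructor
    · rintro ⟨t, ⟨y, hy, rfl⟩, ht⟩
      obtain ⟨z, hz, rfl⟩ := (hq' y s').1 ht
      refine ⟨y ::ᵥ z, ?_, load_update_cons ..⟩
      simp only [hu] at hz
      simpa [List.Vector.mOfFn] using ⟨y, hy, z, hz, rfl⟩
    · rintro ⟨z, hz, rfl⟩
      simp only [List.Vector.mOfFn, Part.bind_eq_bind, Part.mem_bind_iff, Part.pure_eq_some,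
        Part.mem_some_iff] at hz
      obtain ⟨y, hy, z, hz, rfl⟩ := hz
      refine ⟨_, ⟨y, hy, rfl⟩, (hq' y _).2 ⟨z, ?_, (load_update_cons ..).symm⟩⟩
      simpa only [hu] using hz

theorem Computes.comp {m n : ℕ} {f : List.Vector ℕ n →. ℕ} {g : Fin n → List.Vector ℕ m →. ℕ}
    (hf : Computes f) (hg : ∀ i, Computes (g i)) :
    Computes fun v => (List.Vector.mOfFn fun i => g i v) >>= f := by
  intro inp out b hinp hout hne
  obtain ⟨p, hp⟩ := exists_exec_load g hg inp b hinp
  -- The `n` intermediate values occupy the counters from `b` to `b + n - 1`, so the scratch space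
  -- of `f` starts at `b + n`; these values are erased at the end.
  obtain ⟨q, hq⟩ := hf (fun i => b + i) out (b + n) (fun i => by omega) (by omega)
    (fun i => by omega)
  obtain ⟨c, hc⟩ := exists_exec_clear_range b n
  refine ⟨seq p (seq q c), fun s h0 hs s' => ?_⟩
  have hq' : ∀ (z : List.Vector ℕ n) t, q.Exec (load s b z) t ↔
      ∃ y ∈ f z, t = update (load s b z) out y := fun z t => by
    rw [hq (load s b z) (by simp [load, hout, h0])]
    · have : (List.Vector.ofFn fun i : Fin n => load s b z (b + i)) = z := by
        ext i
        simp [load, List.Vector.get_eq_get_toList]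
      rw [this]
    · intro r hr
      simp only [load, if_neg (show ¬ r < b by omega)]
      rw [List.getD_eq_default]
      simp
      omega
  have hclear : ∀ (z : List.Vector ℕ n) y, (fun r => if b ≤ r ∧ r < b + n then 0
      else update (load s b z) out y r) = update s out y := fun z y => by
    funext r
    simp only [update_apply, load]
    by_cases hr : r < b
    · simp [hr, show ¬ b ≤ r by omega]
    · by_cases hr' : r < b + n
      · simp [hr', show b ≤ r by omega, show r ≠ out by omega, hs r (by omega)]
      · rw [List.getD_eq_default]
        · simp [hr, hr', show r ≠ out by omega, hs r (by omega)]
        · simp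
          omega
  simp only [Exec, hp s hs]
  constructor
  · rintro ⟨_, ⟨z, hz, rfl⟩, t, ht, ht'⟩
    obtain ⟨y, hy, rfl⟩ := (hq' z t).1 ht
    exact ⟨y, Part.mem_bind_iff.2 ⟨z, hz, hy⟩, by rw [(hc _ _).1 ht', hclear]⟩
  · rintro ⟨y, hy, rfl⟩
    obtain ⟨z, hz, hy⟩ := Part.mem_bind_iff.1 hy
    exact ⟨_, ⟨z, hz, rfl⟩, _, (hq' z _).2 ⟨y, hy, rfl⟩, (hc _ _).2 (hclear z y).symm⟩

theorem Computes.zero : Computes fun _ : List.Vector ℕ 0 => Part.some 0 := by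
  intro inp out b _ _ _
  refine ⟨skip, fun s h0 _ s' => ?_⟩
  simp [Exec, ← h0]

theorem Computes.get {n : ℕ} (i : Fin n) :
    Computes fun v : List.Vector ℕ n => Part.some (v.get i) := by
  intro inp out b hinp hout hne
  refine ⟨copy (inp i) out b, fun s h0 hs s' => ?_⟩
  rw [exec_copy (hne i) (hinp i).ne hout.ne h0 (hs b le_rfl)]
  simp

theorem Computes.succ : Computes fun v : List.Vector ℕ 1 => Part.some (Nat.succ v.head) := by
  intro inp out b hinp hout hne
  refine ⟨seq (copy (inp 0) out b) (inc out), fun s h0 hs s' => ?_⟩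
  rw [exec_seq (exec_copy (hne 0) (hinp 0).ne hout.ne h0 (hs b le_rfl))]
  simp [Exec]

theorem Computes.prec {n : ℕ} {f : List.Vector ℕ n → ℕ} {g : List.Vector ℕ (n + 2) → ℕ}
    (hf : Computes fun v => Part.some (f v)) (hg : Computes fun v => Part.some (g v)) :
    Computes fun v : List.Vector ℕ (n + 1) => Part.some
      (v.head.rec (f v.tail) fun y IH => g (y ::ᵥ IH ::ᵥ v.tail) : ℕ) := by
  intro inp out b hinp hout hne
  have hinp' : ∀ i : Fin n, Fin.tail inp i < b := fun i => hinp i.succ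
  obtain ⟨p, hp⟩ := hf (Fin.tail inp) (b + 2) (b + 3)
    (fun i => (hinp' i).trans (by omega)) (by omega)
    (fun i => ((hinp' i).trans (by omega)).ne)
  obtain ⟨q, hq⟩ := hg (Fin.cons (b + 1) (Fin.cons (b + 2) (Fin.tail inp))) (b + 3) (b + 4)
    (Fin.cases (by simp) (Fin.cases (by simp) fun i => by
      simpa using (hinp' i).trans (by omega)))
    (by omega)
    (Fin.cases (by simp) (Fin.cases (by simp) fun i => by
      simpa using ((hinp' i).trans (by omega)).ne))
  -- Counter `b` holds the remaining rounds, `b + 1` the index of the recursion, `b + 2` the value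
  -- reached so far and `b + 3` the new value of `g`. The auxiliary counter of the first copy is `b
  -- + 1`, which is `0` again afterwards.
  refine ⟨seq (copy (inp 0) b (b + 1)) (seq p (seq
    (loop b (seq q (seq (clear (b + 2)) (seq (move (b + 3) (b + 2)) (inc (b + 1))))))
    (seq (move (b + 2) out) (clear (b + 1))))), fun s h0 hs s' => ?_⟩
  set v := List.Vector.ofFn fun i => s (Fin.tail inp i) with hv
  set F : ℕ → ℕ := fun i => i.rec (f v) fun y IH => g (y ::ᵥ IH ::ᵥ v) with hF
  rw [exec_seq (exec_copy (by have := hinp 0; omega) (by have := hinp 0; omega) (by omega)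
    (hs b le_rfl) (hs (b + 1) (by omega)))]
  have hp' : ∀ t', p.Exec (update s b (s (inp 0))) t' ↔
      t' = update (update s b (s (inp 0))) (b + 2) (f v) := fun t' => by
    rw [hp _ (by simp [hs]) fun r hr => by
      rw [update_apply, if_neg (by omega)]
      exact hs r (by omega)]
    have : (fun i => update s b (s (inp 0)) (Fin.tail inp i)) = fun i => s (Fin.tail inp i) := by
      funext i
      simp [(hinp' i).ne]
    simp [this, hv]
  rw [exec_seq hp']
  have hloop := exec_loop_of_eq (k := b)
    (p := seq q (seq (clear (b + 2)) (seq (move (b + 3) (b + 2)) (inc (b + 1)))))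
    (fun i => update (update (update s b (s (inp 0) - i)) (b + 1) i) (b + 2) (F i)) (s (inp 0))
    (by simp)
    (fun i _ s' => by
      have hq' := hq (update (update (update (update s b (s (inp 0) - i)) (b + 1) i) (b + 2) (F i))
        b (s (inp 0) - i - 1)) (by simp [hs]) (fun r hr => by
          rw [update_apply, if_neg (by omega), update_apply, if_neg (by omega), update_apply,
            if_neg (by omega), update_apply, if_neg (by omega)]
          exact hs r (by omega))
      have hvec : (List.Vector.ofFn fun j : Fin (n + 2) =>
          (update (update (update (update s b (s (inp 0) - i)) (b + 1) i) (b + 2) (F i))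
            b (s (inp 0) - i - 1)) ((Fin.cons (b + 1) (Fin.cons (b + 2) (Fin.tail inp)) :
              Fin (n + 2) → ℕ) j)) = i ::ᵥ F i ::ᵥ v := by
        rw [hv]
        ext j
        refine Fin.cases ?_ (Fin.cases ?_ fun j => ?_) j
        · simp [update_apply]
        · change _ = F i
          simp
        · have := hinp' j
          simp [update_apply, show Fin.tail inp j ≠ b by omega,
            show Fin.tail inp j ≠ b + 1 by omega, show Fin.tail inp j ≠ b + 2 by omega]
      simp only [hvec, Part.mem_some_iff, exists_eq_left] at hq'
      rw [exec_seq hq', exec_seq (exec_clear _ _), exec_seq (exec_move (by omega) _)]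
      simp only [Exec]
      apply Eq.congr_right
      have hFs : F (i + 1) = g (i ::ᵥ F i ::ᵥ v) := rfl
      have h3 := hs (b + 3) (by omega)
      funext r
      simp only [update_apply, hFs]
      grind)
  have hσ : (fun i => update (update (update s b (s (inp 0) - i)) (b + 1) i) (b + 2) (F i)) 0 =
      update (update s b (s (inp 0))) (b + 2) (f v) := by
    have h1 := hs (b + 1) (by omega)
    have hF0 : F 0 = f v := rfl
    funext r
    simp only [update_apply, hF0]
    grind
  beta_reduce at hσ hloop
  rw [hσ] at hloop
  rw [exec_seq hloop, exec_seq (exec_move (by omega) _), exec_clear]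
  have hN : (List.Vector.ofFn fun i => s (inp i)) = s (inp 0) ::ᵥ v := rfl
  simp only [hN, List.Vector.head_cons, List.Vector.tail_cons, Part.mem_some_iff, exists_eq_left]
  apply Eq.congr_right
  change _ = update s out (F (s (inp 0)))
  have hb0 := hs b le_rfl
  have hb1 := hs (b + 1) (by omega)
  have hb2 := hs (b + 2) (by omega)
  funext r
  simp only [update_apply]
  grind

theorem Computes.rfind {n : ℕ} {f : List.Vector ℕ (n + 1) → ℕ}
    (hf : Computes fun v => Part.some (f v)) :
    Computes fun v => Nat.rfind fun n => Part.some (decide (f (n ::ᵥ v) = 0)) := by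
  intro inp out b hinp hout hne
  obtain ⟨p, hp⟩ := hf (Fin.cons out inp) b (b + 1)
    (Fin.cases (by simpa using Nat.lt_succ_of_lt hout) fun i => by
      simpa using Nat.lt_succ_of_lt (hinp i))
    (by omega)
    (Fin.cases (by simpa using hout.ne) fun i => by simpa using (hinp i).ne)
  -- The output counter itself is the candidate of the search, and `b` holds the value of `f` at it.
  -- The loop ends exactly when this value is `0`, so the scratch counter needs no cleaning.
  refine ⟨seq p (loop b (seq (clear b) (seq (inc out) p))), fun s h0 hs s' => ?_⟩
  set v := List.Vector.ofFn fun i => s (inp i) with hv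
  have hp' : ∀ i t', p.Exec (update s out i) t' ↔
      t' = update (update s out i) b (f (i ::ᵥ v)) := fun i t' => by
    rw [hp _ (by simp [hs, hout.ne']) fun r hr => by
      rw [update_apply, if_neg (by omega)]
      exact hs r (by omega)]
    have : (List.Vector.ofFn fun j : Fin (n + 1) =>
        update s out i ((Fin.cons out inp : Fin (n + 1) → ℕ) j)) = i ::ᵥ v := by
      rw [hv]
      ext j
      refine Fin.cases ?_ (fun j => ?_) j
      · simp
      · simp [update_apply, hne j]
    simp [this]
  have h00 : update s out 0 = s := by rw [← h0]; simp
  rw [exec_seq (by simpa only [h00] using hp' 0)]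
  have hloop := exec_loop (k := b) (p := seq (clear b) (seq (inc out) p))
    (fun i => update (update s out i) b (f (i ::ᵥ v)))
    (fun i _ s' => by
      rw [exec_seq (exec_clear _ _)]
      rw [exec_seq (t := update s out (i + 1)), hp']
      intro t'
      simp only [Exec]
      apply Eq.congr_right
      have hb0 := hs b le_rfl
      funext r
      simp only [update_apply]
      grind) s'
  simp only [h00] at hloop
  rw [hloop]
  apply exists_congr
  intro N
  simp only [update_self]
  have hb0 := hs b le_rfl
  constructor
  · rintro ⟨h1, h2, rfl⟩
    refine ⟨Nat.mem_rfind.2 ⟨by simpa using h2, fun {m} hm => by simpa using h1 m hm⟩, ?_⟩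
    funext r
    simp only [update_apply]
    grind
  · rintro ⟨hN, rfl⟩
    obtain ⟨h1, h2⟩ := Nat.mem_rfind.1 hN
    have h1 : f (N ::ᵥ v) = 0 := by simpa using h1
    refine ⟨fun j hj => by simpa using h2 hj, h1, ?_⟩
    funext r
    simp only [update_apply]
    grind

theorem computes_of_primrec' {n : ℕ} {f : List.Vector ℕ n → ℕ} (hf : Nat.Primrec' f) :
    Computes fun v => Part.some (f v) := by
  induction hf with
  | zero => exact .zero
  | succ => exact .succ
  | get i => exact .get i
  | comp g _ _ hf hg => simpa using Computes.comp hf hg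
  | prec _ _ hf hg => exact .prec hf hg

theorem computes_of_partrec' {n : ℕ} {f : List.Vector ℕ n →. ℕ} (hf : Nat.Partrec' f) :
    Computes f := by
  induction hf with
  | prim hf => exact computes_of_primrec' hf
  | comp g _ _ hf hg => exact .comp hf hg
  | rfind _ hf => exact .rfind hf

/-- Every partial recursive function is the domain of termination of a counter program. -/
theorem exists_exec_iff_dom {f : ℕ →. ℕ} (hf : Partrec f) :
    ∃ p : CounterProg, ∀ n, (∃ s', p.Exec (update 0 0 n) s') ↔ (f n).Dom := by
  obtain ⟨p, hp⟩ := computes_of_partrec' (Nat.Partrec'.part_iff₁.2 hf) (fun _ => 0) 1 2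
    (by simp) (by simp) (by simp)
  refine ⟨p, fun n => ?_⟩
  simp only [hp (update 0 0 n) (by simp) fun r hr => by
    simp [show r ≠ 0 by omega]]
  constructor
  · rintro ⟨_, y, hy, _⟩
    exact Part.dom_iff_mem.2 ⟨y, by simpa using hy⟩
  · intro h
    obtain ⟨y, hy⟩ := Part.dom_iff_mem.1 h
    exact ⟨_, y, by simpa using hy, rfl⟩

end CounterProg

end ALCSelfVPL

namespace ALCSelfVPL

open Function Relation

namespace CounterProg

/-! ## Small steps -/

/-- One step on a list of programs that remain to be executed and a store. -/
def step : List CounterProg × Store → List CounterProg × Store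
  | ([], s) => ([], s)
  | (skip :: K, s) => (K, s)
  | (inc k :: K, s) => (K, update s k (s k + 1))
  | (seq p q :: K, s) => (p :: q :: K, s)
  | (loop k p :: K, s) => if s k = 0 then (K, s) else (p :: loop k p :: K, update s k (s k - 1))

/-- Executing the head of the list costs at least one step. The resulting bound `M < N` lets the
induction hypothesis be applied again to what remains, in particular to a loop that reappears after
its body. -/
theorem exec_of_step_iterate (N : ℕ) : ∀ (p : CounterProg) (K : List CounterProg) (s : Store),
    (step^[N] (p :: K, s)).1 = [] →
      ∃ s', p.Exec s s' ∧ ∃ M < N, (step^[M] (K, s')).1 = [] := by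
  induction N using Nat.strong_induction_on with
  | _ N ih =>
    intro p K s h
    obtain _ | N := N
    · simp at h
    rw [iterate_succ_apply] at h
    cases p with
    | skip => exact ⟨s, rfl, N, N.lt_succ_self, h⟩
    | inc k => exact ⟨_, rfl, N, N.lt_succ_self, h⟩
    | seq p q =>
      obtain ⟨t, ht, M, hM, h⟩ := ih N N.lt_succ_self p (q :: K) s h
      obtain ⟨t', ht', M', hM', h⟩ := ih M (by omega) q K t h
      exact ⟨t', ⟨t, ht, ht'⟩, M', by omega, h⟩
    | loop k p =>
      by_cases h0 : s k = 0
      · rw [step, if_pos h0] at h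
        exact ⟨s, ⟨.refl, h0⟩, N, N.lt_succ_self, h⟩
      · rw [step, if_neg h0] at h
        obtain ⟨t, ht, M, hM, h⟩ := ih N N.lt_succ_self p (loop k p :: K) _ h
        obtain ⟨t', ht', M', hM', h⟩ := ih M (by omega) (loop k p) K t h
        exact ⟨t', ⟨ht'.1.head ⟨h0, ht⟩, ht'.2⟩, M', by omega, h⟩

theorem Exec.exists_step_iterate {p : CounterProg} {s s' : Store} (h : p.Exec s s')
    (K : List CounterProg) : ∃ N, step^[N] (p :: K, s) = (K, s') := by
  induction p generalizing s s' K with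
  | skip =>
    obtain rfl := h
    exact ⟨1, rfl⟩
  | inc k =>
    obtain rfl := h
    exact ⟨1, rfl⟩
  | seq p q ihp ihq =>
    obtain ⟨t, hp, hq⟩ := h
    obtain ⟨M, hM⟩ := ihp hp (q :: K)
    obtain ⟨N, hN⟩ := ihq hq K
    refine ⟨N + (M + 1), ?_⟩
    rw [iterate_add_apply, iterate_succ_apply, step, hM, hN]
  | loop k p ih =>
    obtain ⟨hr, h0⟩ := h
    induction hr using ReflTransGen.head_induction_on with
    | refl => exact ⟨1, by simp [step, h0]⟩
    | head hab _ ih' =>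
      obtain ⟨M, hM⟩ := ih hab.2 (loop k p :: K)
      obtain ⟨N, hN⟩ := ih'
      refine ⟨N + (M + 1), ?_⟩
      rw [iterate_add_apply, iterate_succ_apply, step, if_neg hab.1, hM, hN]

theorem exists_exec_iff (p : CounterProg) (s : Store) :
    (∃ s', p.Exec s s') ↔ ∃ N, (step^[N] ([p], s)).1 = [] := by
  constructor
  · rintro ⟨s', h⟩
    obtain ⟨N, hN⟩ := h.exists_step_iterate []
    exact ⟨N, by rw [hN]⟩
  · rintro ⟨N, hN⟩
    obtain ⟨s', h, _⟩ := exec_of_step_iterate N p [] s hN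
    exact ⟨s', h⟩

/-- The programs that remain to be executed after one step, where the flag tells whether a loop
is entered. -/
def succ : List CounterProg → Bool → List CounterProg
  | [], _ => []
  | skip :: K, _ => K
  | inc _ :: K, _ => K
  | seq p q :: K, _ => p :: q :: K
  | loop k p :: K, b => bif b then p :: loop k p :: K else K

/-- The lists of programs that may remain to be executed before `p :: K` is reduced to `K`. -/
def continuations : CounterProg → List CounterProg → Set (List CounterProg)
  | skip, K => {skip :: K}
  | inc k, K => {inc k :: K}
  | seq p q, K => insert (seq p q :: K) (continuations p (q :: K) ∪ continuations q K)
  | loop k p, K => insert (loop k p :: K) (continuations p (loop k p :: K))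

/-- The recursion is on the program, not on the computation: a loop reappears below its body as the
same list, however often it is entered. This makes the alphabet of the runs finite. -/
theorem finite_continuations (p : CounterProg) (K : List CounterProg) :
    (continuations p K).Finite := by
  induction p generalizing K with
  | skip => exact Set.finite_singleton _
  | inc k => exact Set.finite_singleton _
  | seq p q ihp ihq => exact ((ihp _).union (ihq _)).insert _
  | loop k p ih => exact (ih _).insert _

theorem cons_mem_continuations (p : CounterProg) (K : List CounterProg) :
    p :: K ∈ continuations p K := by
  cases p <;> simp [continuations]

theorem ne_nil_of_mem_continuations {p : CounterProg} {K L : List CounterProg}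
    (h : L ∈ continuations p K) : L ≠ [] := by
  induction p generalizing K with
  | skip => rintro rfl; simp [continuations] at h
  | inc k => rintro rfl; simp [continuations] at h
  | seq p q ihp ihq =>
    rcases h with rfl | h | h
    exacts [List.cons_ne_nil _ _, ihp h, ihq h]
  | loop k p ih =>
    rcases h with rfl | h
    exacts [List.cons_ne_nil _ _, ih h]

theorem succ_mem_continuations {p : CounterProg} {K L : List CounterProg}
    (h : L ∈ continuations p K) (b : Bool) : succ L b ∈ continuations p K ∨ succ L b = K := by
  induction p generalizing K with
  | skip =>
    obtain rfl := h
    exact .inr rfl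
  | inc k =>
    obtain rfl := h
    exact .inr rfl
  | seq p q ihp ihq =>
    rcases h with rfl | h | h
    · exact .inl (.inr (.inl (cons_mem_continuations _ _)))
    · rcases ihp h with h | h
      · exact .inl (.inr (.inl h))
      · exact .inl (.inr (.inr (h ▸ cons_mem_continuations _ _)))
    · rcases ihq h with h | h
      · exact .inl (.inr (.inr h))
      · exact .inr h
  | loop k p ih =>
    rcases h with rfl | h
    · cases b
      · exact .inr rfl
      · exact .inl (.inr (cons_mem_continuations _ _))
    · rcases ih h with h | h
      · exact .inl (.inr h)
      · exact .inl (.inl h)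

end CounterProg

/-! ## Letters that operate on counters -/

/-- Operations on a counter: `dec` is undefined on `0`, and `zero` is undefined elsewhere. -/
inductive CounterOp : Type
  | inc
  | dec
  | zero
  | nop

/-- The effect of an operation. -/
def CounterOp.eff : CounterOp → ℕ → Option ℕ
  | inc, n => some (n + 1)
  | dec, 0 => none
  | dec, n + 1 => some n
  | zero, 0 => some 0
  | zero, _ + 1 => none
  | nop, n => some n

/-- An infinite word in which neighbouring letters are related by `next`, and along which all
counters, starting from `0`, can be operated on as the letters tell; it starts with `n` copies of
`init` and one of `start`. -/
def HasRun {Λ : Type} (next : Λ → Λ → Prop) (op : ℕ → Λ → CounterOp) (init start : Λ)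
    (n : ℕ) : Prop :=
  ∃ (w : ℕ → Λ) (c : ℕ → Store), (∀ i < n, w i = init) ∧ w n = start ∧
    (∀ i, next (w i) (w (i + 1))) ∧ c 0 = 0 ∧ ∀ i k, (op k (w i)).eff (c i k) = some (c (i + 1) k)

namespace CounterProg

/-- The operation on the counter `k` performed by one step. -/
def stepOp (k : ℕ) : List CounterProg → Bool → CounterOp
  | inc j :: _, _ => if k = j then .inc else .nop
  | loop j _ :: _, b => if k = j then bif b then .dec else .zero else .nop
  | _, _ => .nop

theorem finite_stepOp_ne_nop (K : List CounterProg) (b : Bool) :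
    {k | stepOp k K b ≠ .nop}.Finite := by
  rcases K with _ | ⟨_ | j | _ | ⟨j, _⟩, K⟩
  · simp [stepOp]
  · simp [stepOp]
  · exact (Set.finite_singleton j).subset fun k hk => by
      by_contra h
      simp_all [stepOp]
  · simp [stepOp]
  · exact (Set.finite_singleton j).subset fun k hk => by
      by_contra h
      simp_all [stepOp]

/-- The flag `b` is a guess that checks itself: entering a loop decrements, which is undefined at
`0`, and leaving it tests for zero, which is undefined elsewhere. Hence definedness of the
operations forces the correct branch. -/
theorem step_eq_of_eff {K : List CounterProg} {b : Bool} {s s' : Store}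
    (h : ∀ k, (stepOp k K b).eff (s k) = some (s' k)) : step (K, s) = (succ K b, s') := by
  rcases K with _ | ⟨_ | j | ⟨p, q⟩ | ⟨j, p⟩, K⟩
  · have : s = s' := by
      funext k
      simpa [stepOp, CounterOp.eff] using h k
    rw [this, step, succ]
  · have : s = s' := by
      funext k
      simpa [stepOp, CounterOp.eff] using h k
    rw [this, step, succ]
  · have : update s j (s j + 1) = s' := by
      funext k
      have := h k
      by_cases hk : k = j
      · subst hk
        simpa [stepOp, CounterOp.eff] using this
      · simpa [stepOp, hk, CounterOp.eff] using this
    rw [step, this, succ]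
  · have : s = s' := by
      funext k
      simpa [stepOp, CounterOp.eff] using h k
    rw [this, step, succ]
  · have hj := h j
    cases b
    · have h0 : s j = 0 := by
        cases hs : s j with
        | zero => rfl
        | succ m => simp [stepOp, CounterOp.eff, hs] at hj
      have : s = s' := by
        funext k
        have := h k
        by_cases hk : k = j
        · subst hk
          simpa [stepOp, CounterOp.eff, h0] using this
        · simpa [stepOp, hk, CounterOp.eff] using this
      rw [step, if_pos h0, this, succ, cond_false]
    · obtain ⟨m, hm⟩ : ∃ m, s j = m + 1 := by
        cases hs : s j with
        | zero => simp [stepOp, CounterOp.eff, hs] at hj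
        | succ m => exact ⟨m, rfl⟩
      have : update s j (s j - 1) = s' := by
        funext k
        have := h k
        by_cases hk : k = j
        · subst hk
          simpa [stepOp, CounterOp.eff, hm] using this
        · simpa [stepOp, hk, CounterOp.eff] using this
      rw [step, if_neg (by omega), this, succ, cond_true]

theorem exists_eff_eq_step (K : List CounterProg) (s : Store) : ∃ b,
    (∀ k, (stepOp k K b).eff (s k) = some ((step (K, s)).2 k)) ∧ succ K b = (step (K, s)).1 := by
  rcases K with _ | ⟨_ | j | ⟨p, q⟩ | ⟨j, p⟩, K⟩
  -- Only loops consult the flag, so its value is arbitrary here.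
  · exact ⟨true, by simp [stepOp, step, succ, CounterOp.eff]⟩
  · exact ⟨true, by simp [stepOp, step, succ, CounterOp.eff]⟩
  · refine ⟨true, fun k => ?_, rfl⟩
    by_cases hk : k = j
    · subst hk
      simp [stepOp, step, CounterOp.eff]
    · simp [stepOp, step, CounterOp.eff, hk]
  · exact ⟨true, by simp [stepOp, step, succ, CounterOp.eff]⟩
  · cases hs : s j with
    | zero =>
      refine ⟨false, fun k => ?_, by simp [step, succ, hs]⟩
      by_cases hk : k = j
      · subst hk
        simp [stepOp, step, CounterOp.eff, hs]
      · simp [stepOp, step, CounterOp.eff, hs, hk]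
    | succ m =>
      refine ⟨true, fun k => ?_, by simp [step, succ, hs]⟩
      by_cases hk : k = j
      · subst hk
        simp [stepOp, step, CounterOp.eff, hs]
      · simp [stepOp, step, CounterOp.eff, hs, hk]

/-- The letters of the words that describe the execution of a program: one for loading the input,
one for the start of the program, and one for each step. -/
abbrev RunLetter (p : CounterProg) : Type := Option (Option (continuations p [] × Bool))

/-- The letters that may follow a given letter. -/
def runNext (p : CounterProg) : RunLetter p → RunLetter p → Prop
  | none, none => True
  | none, some none => True
  | some none, some (some (K, _)) => K.1 = [p]
  | some (some (K, b)), some (some (K', _)) => K'.1 = succ K.1 b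
  | _, _ => False

/-- The counter operation of a letter; the input is loaded into the counter `0`. -/
def runOp (p : CounterProg) (k : ℕ) : RunLetter p → CounterOp
  | none => if k = 0 then .inc else .nop
  | some none => .nop
  | some (some (K, b)) => stepOp k K.1 b

theorem finite_runOp_ne_nop (p : CounterProg) (l : RunLetter p) :
    {k | runOp p k l ≠ .nop}.Finite := by
  rcases l with _ | _ | ⟨K, b⟩
  · exact (Set.finite_singleton 0).subset fun k hk => by
      by_contra h
      simp_all [runOp]
  · simp [runOp]
  · exact finite_stepOp_ne_nop K.1 b

/-- The first `n` letters load the input and the next one marks the start, so the letter at position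
`n + 1 + i` describes the configuration after `i` steps. Its program list is a continuation, hence
not empty. -/
theorem not_halt_of_hasRun {p : CounterProg} {n : ℕ}
    (h : HasRun (runNext p) (runOp p) none (some none) n) (i : ℕ) :
    (step^[i] ([p], update (0 : Store) 0 n)).1 ≠ [] := by
  obtain ⟨w, c, hinit, hstart, hnext, hc0, hc⟩ := h
  have hload : ∀ i ≤ n, c i = update (0 : Store) 0 i := by
    intro i hi
    induction i with
    | zero => simp [hc0]
    | succ i ih =>
      have ih := ih (by omega)
      funext k
      have := hc i k
      rw [hinit i (by omega), ih] at this
      by_cases hk : k = 0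
      · subst hk
        simpa [runOp, CounterOp.eff, eq_comm] using this
      · simpa [runOp, CounterOp.eff, eq_comm, hk] using this
  have key : ∀ i, ∃ K b, w (n + 1 + i) = some (some (K, b)) ∧
      step^[i] ([p], update (0 : Store) 0 n) = (K.1, c (n + 1 + i)) := by
    intro i
    induction i with
    | zero =>
      have h1 := hnext n
      rw [hstart] at h1
      rcases hw : w (n + 1) with _ | _ | ⟨K, b⟩
      · simp [hw, runNext] at h1
      · simp [hw, runNext] at h1
      · refine ⟨K, b, rfl, ?_⟩
        have h1 : K.1 = [p] := by simpa [hw, runNext] using h1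
        have h2 : c (n + 1) = update (0 : Store) 0 n := by
          rw [← hload n le_rfl]
          funext k
          have := hc n k
          rw [hstart] at this
          simpa [runOp, CounterOp.eff, eq_comm] using this
        simp [h1, h2]
    | succ i ih =>
      obtain ⟨K, b, hw, hs⟩ := ih
      have h1 := hnext (n + 1 + i)
      have h2 := hc (n + 1 + i)
      rw [hw] at h1
      simp only [hw, runOp] at h2
      rw [iterate_succ_apply', hs, step_eq_of_eff h2]
      rcases hw' : w (n + 1 + i + 1) with _ | _ | ⟨K', b'⟩
      · simp [hw', runNext] at h1
      · simp [hw', runNext] at h1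
      · have h1 : K'.1 = succ K.1 b := by simpa [hw', runNext] using h1
        exact ⟨K', b', rfl, by rw [h1, add_assoc]⟩
  obtain ⟨K, b, _, hs⟩ := key i
  rw [hs]
  exact ne_nil_of_mem_continuations K.2

theorem hasRun_of_not_halt {p : CounterProg} {n : ℕ}
    (h : ∀ i, (step^[i] ([p], update (0 : Store) 0 n)).1 ≠ []) :
    HasRun (runNext p) (runOp p) none (some none) n := by
  set C : ℕ → List CounterProg × Store := fun i => step^[i] ([p], update (0 : Store) 0 n) with hC
  have hCs : ∀ i, C (i + 1) = step (C i) := fun i => iterate_succ_apply' _ _ _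
  choose b hb hb' using fun i => exists_eff_eq_step (C i).1 (C i).2
  have hmem : ∀ i, (C i).1 ∈ continuations p [] := by
    intro i
    induction i with
    | zero => exact cons_mem_continuations p []
    | succ i ih =>
      rw [hCs, ← Prod.mk.eta (p := C i), ← hb']
      -- The set of continuations can be left only to the empty list, which would mean termination.
      refine (succ_mem_continuations ih _).resolve_right fun h0 => h (i + 1) ?_
      change (C (i + 1)).1 = []
      rw [hCs, ← Prod.mk.eta (p := C i), ← hb', h0]
  refine ⟨fun i => if i < n then none else if i = n then some none else
    some (some (⟨(C (i - (n + 1))).1, hmem _⟩, b (i - (n + 1)))),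
    fun i => if i ≤ n then update (0 : Store) 0 i else (C (i - (n + 1))).2, ?_, ?_, ?_, ?_, ?_⟩
  · intro i hi
    simp [hi]
  · simp
  · intro i
    rcases lt_trichotomy i n with hi | rfl | hi
    · by_cases hi' : i + 1 < n
      · simp [hi, hi', runNext]
      · simp [hi, show i + 1 = n by omega, runNext]
    · simp [runNext, hC]
    · obtain ⟨d, rfl⟩ := Nat.exists_eq_add_of_lt hi
      simp only [show ¬ n + d + 1 < n by omega, show n + d + 1 ≠ n by omega,
        show ¬ n + d + 1 + 1 < n by omega, show n + d + 1 + 1 ≠ n by omega, if_false, runNext,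
        show n + d + 1 - (n + 1) = d by omega, show n + d + 1 + 1 - (n + 1) = d + 1 by omega]
      rw [hCs, hb']
  · simp
  · intro i k
    rcases lt_trichotomy i n with hi | rfl | hi
    · simp only [hi, if_true, runOp, hi.le, Nat.succ_le_of_lt hi]
      by_cases hk : k = 0
      · subst hk
        simp [CounterOp.eff]
      · simp [CounterOp.eff, hk]
    · simp [runOp, CounterOp.eff, hC]
    · obtain ⟨d, rfl⟩ := Nat.exists_eq_add_of_lt hi
      simp only [show ¬ n + d + 1 < n by omega, show n + d + 1 ≠ n by omega,
        show ¬ n + d + 1 ≤ n by omega, show ¬ n + d + 1 + 1 ≤ n by omega, if_false, runOp,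
        show n + d + 1 - (n + 1) = d by omega, show n + d + 1 + 1 - (n + 1) = d + 1 by omega]
      rw [hb, hCs]

theorem hasRun_iff (p : CounterProg) (n : ℕ) :
    HasRun (runNext p) (runOp p) none (some none) n ↔ ¬ ∃ s', p.Exec (update (0 : Store) 0 n) s' := by
  rw [exists_exec_iff, not_exists]
  exact ⟨not_halt_of_hasRun, hasRun_of_not_halt⟩

end CounterProg

/-! ### Renaming the letters to natural numbers -/

theorem HasRun.map {Λ Λ' : Type} {next : Λ → Λ → Prop} {op : ℕ → Λ → CounterOp} {init start : Λ}
    {n : ℕ} (e : Λ ≃ Λ') (h : HasRun next op init start n) :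
    HasRun (fun a b => next (e.symm a) (e.symm b)) (fun k a => op k (e.symm a))
      (e init) (e start) n := by
  obtain ⟨w, c, h1, h2, h3, h4, h5⟩ := h
  exact ⟨fun i => e (w i), c, fun i hi => congrArg e (h1 i hi), congrArg e h2, by simpa using h3, h4,
    by simpa using h5⟩

theorem hasRun_map_iff {Λ Λ' : Type} {next : Λ → Λ → Prop} {op : ℕ → Λ → CounterOp}
    {init start : Λ} {n : ℕ} (e : Λ ≃ Λ') :
    HasRun (fun a b => next (e.symm a) (e.symm b)) (fun k a => op k (e.symm a))
      (e init) (e start) n ↔ HasRun next op init start n :=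
  ⟨fun h => by simpa using h.map e.symm, fun h => h.map e⟩

/-- The complement of the domain of a partial recursive function is described by runs over a
finite alphabet, on which finitely many counters are operated. -/
theorem exists_hasRun_iff_not_dom {f : ℕ →. ℕ} (hf : Partrec f) :
    ∃ (S T : Finset ℕ) (next : S → S → Prop) (op : ℕ → S → CounterOp) (init start : S),
      (∀ k ∉ T, ∀ a, op k a = .nop) ∧ ∀ n, HasRun next op init start n ↔ ¬ (f n).Dom := by
  obtain ⟨p, hp⟩ := CounterProg.exists_exec_iff_dom hf
  have := (CounterProg.finite_continuations p []).to_subtype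
  obtain ⟨m, ⟨e⟩⟩ := Finite.exists_equiv_fin p.RunLetter
  let e' : p.RunLetter ≃ Finset.range m := e.trans
    ⟨fun i => ⟨i, Finset.mem_range.2 i.2⟩, fun a => ⟨a, Finset.mem_range.1 a.2⟩,
      fun _ => rfl, fun _ => rfl⟩
  have hT := Set.finite_iUnion fun l => p.finite_runOp_ne_nop l
  refine ⟨Finset.range m, hT.toFinset, fun a b => p.runNext (e'.symm a) (e'.symm b), fun k a => p.runOp k (e'.symm a), e' none,
    e' (some none), fun k hk a => ?_, fun n => (hasRun_map_iff e').trans ?_⟩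
  · by_contra h
    exact hk (hT.mem_toFinset.2 (Set.mem_iUnion.2 ⟨_, h⟩))
  · rw [CounterProg.hasRun_iff, hp]

end ALCSelfVPL

namespace ALCSelfVPL

/-! ## Separated words -/

theorem separatedWord_nil {S : Finset ℕ} (x : ℕ) :
    separatedWord x ([] : List (S × Decoration)) = [] := rfl

theorem separatedWord_singleton {S : Finset ℕ} (x : ℕ) (p : S × Decoration) :
    separatedWord x [p] = [.role (decorate (p.1.1, p.2))] := rfl

theorem separatedWord_cons_cons {S : Finset ℕ} (x : ℕ) (p q : S × Decoration)
    (w : List (S × Decoration)) :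
    separatedWord x (p :: q :: w) =
      .role (decorate (p.1.1, p.2)) :: .role (.internal x) :: separatedWord x (q :: w) := rfl

theorem separatedWord_concat {S : Finset ℕ} (x : ℕ) {w : List (S × Decoration)} (hw : w ≠ [])
    (p : S × Decoration) :
    separatedWord x (w ++ [p]) =
      separatedWord x w ++ [.role (.internal x), .role (decorate (p.1.1, p.2))] := by
  induction w with
  | nil => exact absurd rfl hw
  | cons q w ih =>
    cases w with
    | nil => rfl
    | cons q' w =>
      rw [List.cons_append, List.cons_append, separatedWord_cons_cons, ← List.cons_append,
        ih (List.cons_ne_nil _ _), separatedWord_cons_cons]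
      rfl

theorem decorate_injective : Function.Injective decorate := by
  rintro ⟨a, d⟩ ⟨b, e⟩ h
  cases d <;> cases e <;> simp_all [decorate]

theorem separatedWord_injective {S : Finset ℕ} (x : ℕ) :
    Function.Injective (separatedWord x : List (S × Decoration) → List Letter) := by
  have hd : ∀ p q : S × Decoration,
      Letter.role (decorate (p.1.1, p.2)) = .role (decorate (q.1.1, q.2)) → p = q := by
    intro p q h
    have := decorate_injective (Letter.role.inj h)
    exact Prod.ext (Subtype.ext (Prod.ext_iff.1 this).1) (Prod.ext_iff.1 this).2
  intro v w h
  induction v generalizing w with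
  | nil =>
    rcases w with _ | ⟨q, _ | ⟨q', w⟩⟩
    · rfl
    · simp [separatedWord_nil, separatedWord_singleton] at h
    · simp [separatedWord_nil, separatedWord_cons_cons] at h
  | cons p v ih =>
    rcases v with _ | ⟨p', v⟩ <;> rcases w with _ | ⟨q, _ | ⟨q', w⟩⟩
    · simp [separatedWord_nil, separatedWord_singleton] at h
    · rw [separatedWord_singleton, separatedWord_singleton, List.cons.injEq] at h
      rw [hd p q h.1]
    · simp [separatedWord_cons_cons, separatedWord_singleton] at h
    · simp [separatedWord_nil, separatedWord_cons_cons] at h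
    · simp [separatedWord_cons_cons, separatedWord_singleton] at h
    · rw [separatedWord_cons_cons, separatedWord_cons_cons, List.cons.injEq, List.cons.injEq] at h
      rw [hd p q h.1, ih h.2.2]

/-! ## Automata with one counter operated on by the letters -/

/-- The decoration under which a visibly pushdown automaton performs a counter operation. -/
def CounterOp.decoration : CounterOp → Decoration
  | inc => .c
  | dec => .r
  | zero => .r
  | nop => .i

/-- The words for which a counter with initial value `n` can be operated on by all letters if
`f = 1`, and by all letters except for the last one if `f = 2`. -/
def Ends {α : Type} (op : α → CounterOp) (f : Fin 3) : ℕ → List α → Prop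
  | _, [] => False
  | n, a :: v =>
      (∃ m, (op a).eff n = some m ∧ (v = [] ∧ f = 1 ∨ Ends op f m v)) ∨
        (op a).eff n = none ∧ v = [] ∧ f = 2

/-- The separated word over the letters decorated as their counter operations require. -/
def opWord {S : Finset ℕ} (x : ℕ) (op : S → CounterOp) (v : List S) : List Letter :=
  separatedWord x (v.map fun a => (a, (op a).decoration))

variable {S : Finset ℕ}

/-- A visibly pushdown automaton that keeps the value of the counter on its stack. The state `0`
expects a letter, `1` expects a separator, and `2` is reached by operations that are undefined. -/
noncomputable def counterVPA (x : ℕ) (op : S → CounterOp) (f : Fin 3) : VPA where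
  initial := [0]
  final := [f.1]
  calls := S.attach.toList.flatMap fun a =>
    match op a with
    | .inc => [(0, a.1, 1, 0)]
    | _ => []
  internals := (1, .inl x, 0) :: S.attach.toList.flatMap fun a =>
    match op a with
    | .nop => [(0, .inl a.1, 1)]
    | _ => []
  returns := S.attach.toList.flatMap fun a =>
    match op a with
    -- Decrements and zero tests are both returns, since only returns can see the bottom of the
    -- stack. A failing zero test pops a symbol, which is harmless because no transition leaves
    -- state `2`.
    | .dec => [(0, a.1, some 0, 1), (0, a.1, none, 2)]
    | .zero => [(0, a.1, none, 1), (0, a.1, some 0, 2)]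
    | _ => []

variable (x : ℕ) (op : S → CounterOp) (f : Fin 3)

/-! ### Transitions and language of the counter automaton -/

theorem mem_calls {q a q' γ : ℕ} : (q, a, q', γ) ∈ (counterVPA x op f).calls ↔
    q = 0 ∧ q' = 1 ∧ γ = 0 ∧ ∃ h : a ∈ S, op ⟨a, h⟩ = .inc := by
  simp only [counterVPA, List.mem_flatMap, Finset.mem_toList, Finset.mem_attach, true_and]
  constructor
  · rintro ⟨b, hb⟩
    cases ho : op b <;> simp only [ho, List.mem_singleton, List.not_mem_nil, Prod.mk.injEq] at hb
    obtain ⟨rfl, rfl, rfl, rfl⟩ := hb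
    exact ⟨rfl, rfl, rfl, b.2, ho⟩
  · rintro ⟨rfl, rfl, rfl, h, ho⟩
    exact ⟨⟨a, h⟩, by simp [ho]⟩

theorem mem_internals {q q' : ℕ} {l : ℕ ⊕ ConceptName} :
    (q, l, q') ∈ (counterVPA x op f).internals ↔ q = 1 ∧ l = .inl x ∧ q' = 0 ∨
      q = 0 ∧ q' = 1 ∧ ∃ a : S, l = .inl a.1 ∧ op a = .nop := by
  simp only [counterVPA, List.mem_cons, List.mem_flatMap, Finset.mem_toList, Finset.mem_attach,
    true_and, Prod.mk.injEq]
  refine or_congr Iff.rfl ?_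
  constructor
  · rintro ⟨b, hb⟩
    cases ho : op b <;> simp only [ho, List.mem_singleton, List.not_mem_nil, Prod.mk.injEq] at hb
    obtain ⟨rfl, rfl, rfl⟩ := hb
    exact ⟨rfl, rfl, b, rfl, ho⟩
  · rintro ⟨rfl, rfl, a, rfl, ho⟩
    exact ⟨a, by simp [ho]⟩

theorem mem_returns {q a q' : ℕ} {γ : Option ℕ} :
    (q, a, γ, q') ∈ (counterVPA x op f).returns ↔ q = 0 ∧ ∃ h : a ∈ S,
      op ⟨a, h⟩ = .dec ∧ (γ = some 0 ∧ q' = 1 ∨ γ = none ∧ q' = 2) ∨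
      op ⟨a, h⟩ = .zero ∧ (γ = none ∧ q' = 1 ∨ γ = some 0 ∧ q' = 2) := by
  simp only [counterVPA, List.mem_flatMap, Finset.mem_toList, Finset.mem_attach, true_and]
  constructor
  · rintro ⟨b, hb⟩
    cases ho : op b <;> simp only [ho, List.mem_cons, List.not_mem_nil, Prod.mk.injEq] at hb
    · rcases hb with ⟨rfl, rfl, rfl, rfl⟩ | ⟨rfl, rfl, rfl, rfl⟩ | h
      · exact ⟨rfl, b.2, .inl ⟨ho, .inl ⟨rfl, rfl⟩⟩⟩
      · exact ⟨rfl, b.2, .inl ⟨ho, .inr ⟨rfl, rfl⟩⟩⟩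
      · exact h.elim
    · rcases hb with ⟨rfl, rfl, rfl, rfl⟩ | ⟨rfl, rfl, rfl, rfl⟩ | h
      · exact ⟨rfl, b.2, .inr ⟨ho, .inl ⟨rfl, rfl⟩⟩⟩
      · exact ⟨rfl, b.2, .inr ⟨ho, .inr ⟨rfl, rfl⟩⟩⟩
      · exact h.elim
  · rintro ⟨rfl, h, ⟨ho, ⟨rfl, rfl⟩ | ⟨rfl, rfl⟩⟩ | ⟨ho, ⟨rfl, rfl⟩ | ⟨rfl, rfl⟩⟩⟩ <;>
      exact ⟨⟨a, h⟩, by simp [ho]⟩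

theorem counterVPA_step_zero {l : Letter} {n : ℕ} {c : ℕ × List ℕ}
    (h : (counterVPA x op f).Step l (0, List.replicate n 0) c) :
    ∃ a : S, l = .role (decorate (a.1, (op a).decoration)) ∧
      ((∃ m, (op a).eff n = some m ∧ c = (1, List.replicate m 0)) ∨
        (op a).eff n = none ∧ c.1 = 2) := by
  obtain ⟨q, σ⟩ := c
  rcases l with (a | a | a) | B
  · obtain ⟨γ, hγ, rfl⟩ := h
    obtain ⟨_, rfl, rfl, ha, ho⟩ := (mem_calls x op f).1 hγ
    exact ⟨⟨a, ha⟩, by simp [ho, CounterOp.decoration, decorate],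
      .inl ⟨n + 1, by simp [ho, CounterOp.eff], rfl⟩⟩
  · obtain ⟨h, rfl⟩ := h
    rcases (mem_internals x op f).1 h with ⟨h, _⟩ | ⟨_, rfl, a, ha, ho⟩
    · simp at h
    · obtain rfl := Sum.inl.inj ha
      exact ⟨a, by simp [ho, CounterOp.decoration, decorate],
        .inl ⟨n, by simp [ho, CounterOp.eff], rfl⟩⟩
  · rcases h with ⟨γ, hσ, h⟩ | ⟨hσ, rfl, h⟩
    · obtain _ | n := n
      · simp at hσ
      rw [List.replicate_succ, List.cons.injEq] at hσ
      obtain ⟨rfl, rfl⟩ := hσ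
      obtain ⟨_, ha, ⟨ho, h⟩ | ⟨ho, h⟩⟩ := (mem_returns x op f).1 h
      · refine ⟨⟨a, ha⟩, by simp [ho, CounterOp.decoration, decorate],
          .inl ⟨n, by simp [ho, CounterOp.eff], ?_⟩⟩
        simpa using h
      · refine ⟨⟨a, ha⟩, by simp [ho, CounterOp.decoration, decorate],
          .inr ⟨by simp [ho, CounterOp.eff], ?_⟩⟩
        simpa using h
    · obtain rfl : n = 0 := by simpa using hσ
      obtain ⟨_, ha, ⟨ho, h⟩ | ⟨ho, h⟩⟩ := (mem_returns x op f).1 h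
      · refine ⟨⟨a, ha⟩, by simp [ho, CounterOp.decoration, decorate],
          .inr ⟨by simp [ho, CounterOp.eff], ?_⟩⟩
        simpa using h
      · refine ⟨⟨a, ha⟩, by simp [ho, CounterOp.decoration, decorate],
          .inl ⟨0, by simp [ho, CounterOp.eff], ?_⟩⟩
        simpa using h
  · obtain ⟨h, rfl⟩ := h
    simp [mem_internals] at h

theorem counterVPA_step_of_eff_eq_some {a : S} {n m : ℕ} (h : (op a).eff n = some m) :
    (counterVPA x op f).Step (.role (decorate (a.1, (op a).decoration)))
      (0, List.replicate n 0) (1, List.replicate m 0) := by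
  cases ho : op a <;> rw [ho] at h <;> simp only [CounterOp.decoration, decorate]
  · obtain rfl : n + 1 = m := by simpa [CounterOp.eff] using h
    exact ⟨0, (mem_calls x op f).2 ⟨rfl, rfl, rfl, a.2, ho⟩, rfl⟩
  · obtain _ | n := n
    · simp [CounterOp.eff] at h
    obtain rfl : n = m := by simpa [CounterOp.eff] using h
    exact .inl ⟨0, rfl, (mem_returns x op f).2 ⟨rfl, a.2, .inl ⟨ho, .inl ⟨rfl, rfl⟩⟩⟩⟩
  · obtain _ | n := n
    · obtain rfl : 0 = m := by simpa [CounterOp.eff] using h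
      exact .inr ⟨rfl, rfl, (mem_returns x op f).2 ⟨rfl, a.2, .inr ⟨ho, .inl ⟨rfl, rfl⟩⟩⟩⟩
    · simp [CounterOp.eff] at h
  · obtain rfl : n = m := by simpa [CounterOp.eff] using h
    exact ⟨(mem_internals x op f).2 (.inr ⟨rfl, rfl, a, rfl, ho⟩), rfl⟩

theorem counterVPA_step_of_eff_eq_none {a : S} {n : ℕ} (h : (op a).eff n = none) :
    ∃ σ, (counterVPA x op f).Step (.role (decorate (a.1, (op a).decoration)))
      (0, List.replicate n 0) (2, σ) := by
  cases ho : op a <;> rw [ho] at h <;> simp only [CounterOp.decoration, decorate]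
  · simp [CounterOp.eff] at h
  · obtain _ | n := n
    · exact ⟨[], .inr ⟨rfl, rfl, (mem_returns x op f).2
        ⟨rfl, a.2, .inl ⟨ho, .inr ⟨rfl, rfl⟩⟩⟩⟩⟩
    · simp [CounterOp.eff] at h
  · obtain _ | n := n
    · simp [CounterOp.eff] at h
    · exact ⟨List.replicate n 0, .inl ⟨0, rfl, (mem_returns x op f).2
        ⟨rfl, a.2, .inr ⟨ho, .inr ⟨rfl, rfl⟩⟩⟩⟩⟩
  · simp [CounterOp.eff] at h

theorem counterVPA_step_one {l : Letter} {σ : List ℕ} {c : ℕ × List ℕ} :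
    (counterVPA x op f).Step l (1, σ) c ↔ l = .role (.internal x) ∧ c = (0, σ) := by
  obtain ⟨q, σ'⟩ := c
  rcases l with (a | a | a) | B
  · simp [VPA.Step, mem_calls]
  · simp [VPA.Step, mem_internals, and_assoc]
  · simp [VPA.Step, mem_returns]
  · simp [VPA.Step, mem_internals]

theorem not_counterVPA_step_two {l : Letter} {σ : List ℕ} {c : ℕ × List ℕ} :
    ¬ (counterVPA x op f).Step l (2, σ) c := by
  obtain ⟨q, σ'⟩ := c
  rcases l with (a | a | a) | B
  · simp [VPA.Step, mem_calls]
  · simp [VPA.Step, mem_internals]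
  · simp [VPA.Step, mem_returns]
  · simp [VPA.Step, mem_internals]

variable {f}

theorem Ends.ne_nil {n : ℕ} {v : List S} (h : Ends op f n v) : v ≠ [] := by
  rintro rfl
  exact h

theorem opWord_cons {v : List S} (a : S) (hv : v ≠ []) : opWord x op (a :: v) =
    .role (decorate (a.1, (op a).decoration)) :: .role (.internal x) :: opWord x op v := by
  cases v with
  | nil => exact absurd rfl hv
  | cons b v => rfl

/-- Letters and separators alternate, so the recursion removes two symbols at a time. The condition
`f ≠ 0` excludes the empty word and words that end with a separator. -/
theorem ends_of_counterVPA_run (hf : f ≠ 0) : ∀ (u : List Letter) {n : ℕ} {σ : List ℕ},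
    (counterVPA x op f).Run u (0, List.replicate n 0) (f.1, σ) →
      ∃ v, Ends op f n v ∧ u = opWord x op v
  | [], n, σ, h => absurd (Fin.ext (Prod.ext_iff.1 h).1.symm) hf
  | [l], n, σ, ⟨c, hs, h⟩ => by
    obtain ⟨a, rfl, ⟨m, hm, rfl⟩ | ⟨hm, hc⟩⟩ := counterVPA_step_zero x op f hs
    · refine ⟨[a], .inl ⟨m, hm, .inl ⟨rfl, ?_⟩⟩, rfl⟩
      exact Fin.ext (Prod.ext_iff.1 h).1.symm
    · refine ⟨[a], .inr ⟨hm, rfl, ?_⟩, rfl⟩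
      exact Fin.ext ((Prod.ext_iff.1 h).1.symm.trans hc)
  | l :: l' :: u, n, σ, ⟨c, hs, c', hs', h⟩ => by
    obtain ⟨a, rfl, ⟨m, hm, rfl⟩ | ⟨hm, hc⟩⟩ := counterVPA_step_zero x op f hs
    · obtain ⟨rfl, rfl⟩ := (counterVPA_step_one x op f).1 hs'
      obtain ⟨v, hv, rfl⟩ := ends_of_counterVPA_run hf u h
      exact ⟨a :: v, .inl ⟨m, hm, .inr hv⟩, (opWord_cons x op a (hv.ne_nil op)).symm⟩
    · obtain ⟨q, σ'⟩ := c
      obtain rfl : q = 2 := hc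
      exact (not_counterVPA_step_two x op f hs').elim

theorem Ends.exists_counterVPA_run {n : ℕ} {v : List S} (h : Ends op f n v) :
    ∃ σ, (counterVPA x op f).Run (opWord x op v) (0, List.replicate n 0) (f.1, σ) := by
  induction v generalizing n with
  | nil => exact h.elim
  | cons a v ih =>
    rcases h with ⟨m, hm, ⟨rfl, rfl⟩ | h⟩ | ⟨hm, rfl, rfl⟩
    · exact ⟨_, _, counterVPA_step_of_eff_eq_some x op 1 hm, rfl⟩
    · obtain ⟨σ, hσ⟩ := ih h
      rw [opWord_cons x op a (h.ne_nil op)]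
      exact ⟨σ, _, counterVPA_step_of_eff_eq_some x op f hm, _,
        (counterVPA_step_one x op f).2 ⟨rfl, rfl⟩, hσ⟩
    · obtain ⟨σ, hσ⟩ := counterVPA_step_of_eff_eq_none x op 2 hm
      exact ⟨σ, _, hσ, rfl⟩

theorem mem_counterVPA_language (hf : f ≠ 0) {u : List Letter} :
    u ∈ (counterVPA x op f).language ↔ ∃ v, Ends op f 0 v ∧ u = opWord x op v := by
  constructor
  · rintro ⟨q, hq, q', hq', σ, h⟩
    obtain rfl := List.mem_singleton.1 hq
    obtain rfl := List.mem_singleton.1 hq'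
    exact ends_of_counterVPA_run x op hf u (n := 0) h
  · rintro ⟨v, hv, rfl⟩
    obtain ⟨σ, h⟩ := hv.exists_counterVPA_run x op
    exact ⟨0, List.mem_singleton_self _, f.1, List.mem_singleton_self _, σ, h⟩

/-- The language of the words on which the counter, starting from `0`, behaves as required. -/
def endsLanguage (op : S → CounterOp) (f : Fin 3) : Language S := {v | Ends op f 0 v}

/-- The operation of a letter determines its decoration, so every word has only one candidate for
its encoding; injectivity of `separatedWord` identifies an accepted word with this candidate. -/
theorem encodes_counterVPA (hf : f ≠ 0) :
    Encodes x (counterVPA x op f).language (endsLanguage op f) := by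
  constructor
  · intro u hu
    obtain ⟨v, _, rfl⟩ := (mem_counterVPA_language x op hf).1 hu
    exact ⟨_, rfl⟩
  · intro v
    constructor
    · intro hv
      exact ⟨_, (mem_counterVPA_language x op hf).2 ⟨v, hv, rfl⟩, by simp [Function.comp_def]⟩
    · rintro ⟨w, hw, rfl⟩
      obtain ⟨v, hv, h⟩ := (mem_counterVPA_language x op hf).1 hw
      rw [separatedWord_injective x h]
      simpa [Function.comp_def] using (show v ∈ endsLanguage op f from hv)

/-! ### The encoded languages as DOCA languages -/

/-- The deterministic one-counter automaton that operates on its counter as the letters tell. -/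
def counterDOCA {α : Type} (op : α → CounterOp) (f : Fin 3) : DOCA α (Fin 3) where
  start := 0
  accept := {f}
  step q z l := l.bind fun a => if q = 2 then none else
    match op a, z with
    | .inc, _ => some (1, .inc)
    | .dec, true => some (2, .keep)
    | .dec, false => some (1, .dec)
    | .zero, true => some (1, .keep)
    | .zero, false => some (2, .keep)
    | .nop, _ => some (1, .keep)
  deterministic q z h := by simp at h

theorem counterDOCA_move_none {α : Type} (op : α → CounterOp) (f : Fin 3)
    {c c' : Fin 3 × ℕ} : ¬ (counterDOCA op f).Move none c c' := by
  rintro ⟨act, h, _⟩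
  simp [counterDOCA] at h

theorem counterDOCA_move_some {α : Type} (op : α → CounterOp) (f : Fin 3) {a : α} {q : Fin 3}
    {n : ℕ} {c : Fin 3 × ℕ} : (counterDOCA op f).Move (some a) (q, n) c ↔ q ≠ 2 ∧
      ((∃ m, (op a).eff n = some m ∧ c = (1, m)) ∨ (op a).eff n = none ∧ c = (2, n)) := by
  obtain ⟨q', m⟩ := c
  by_cases hq : q = 2
  · simp [DOCA.Move, counterDOCA, hq]
  · cases ho : op a <;> rcases n with _ | n <;>
      simp [DOCA.Move, counterDOCA, hq, ho, CounterOp.eff, CounterAction.apply, eq_comm]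

/-- State `2` has no outgoing moves, so a failing operation must be the last one; the first
alternative covers computations that read nothing more. -/
theorem ends_of_counterDOCA_run {α : Type} (op : α → CounterOp) (f : Fin 3) {v : List α}
    {c c' : Fin 3 × ℕ} (h : (counterDOCA op f).Run v c c') (hc' : c'.1 = f) :
    c.1 = f ∧ v = [] ∨ c.1 ≠ 2 ∧ Ends op f c.2 v := by
  induction h with
  | refl c => exact .inl ⟨hc', rfl⟩
  | silent hm => exact (counterDOCA_move_none op f hm).elim
  | @read c c₁ c' a w hm _ ih =>
    obtain ⟨q, n⟩ := c
    obtain ⟨hq, ⟨m, he, rfl⟩ | ⟨he, rfl⟩⟩ := (counterDOCA_move_some op f).1 hm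
    · rcases ih hc' with ⟨h, rfl⟩ | ⟨_, h⟩
      · exact .inr ⟨hq, .inl ⟨m, he, .inl ⟨rfl, h.symm⟩⟩⟩
      · exact .inr ⟨hq, .inl ⟨m, he, .inr h⟩⟩
    · rcases ih hc' with ⟨h, rfl⟩ | ⟨h, _⟩
      · exact .inr ⟨hq, .inr ⟨he, rfl, h.symm⟩⟩
      · exact absurd rfl h

theorem Ends.exists_counterDOCA_run {α : Type} {op : α → CounterOp} {f : Fin 3} {v : List α}
    {n : ℕ} (h : Ends op f n v) {q : Fin 3} (hq : q ≠ 2) :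
    ∃ m, (counterDOCA op f).Run v (q, n) (f, m) := by
  induction v generalizing n q with
  | nil => exact h.elim
  | cons a v ih =>
    rcases h with ⟨m, hm, ⟨rfl, rfl⟩ | h⟩ | ⟨hm, rfl, rfl⟩
    · exact ⟨m, .read ((counterDOCA_move_some op 1).2 ⟨hq, .inl ⟨m, hm, rfl⟩⟩) (.refl _)⟩
    · obtain ⟨m', h'⟩ := ih h (q := 1) (by decide)
      exact ⟨m', .read ((counterDOCA_move_some op f).2 ⟨hq, .inl ⟨m, hm, rfl⟩⟩) h'⟩
    · exact ⟨n, .read ((counterDOCA_move_some op 2).2 ⟨hq, .inr ⟨hm, rfl⟩⟩) (.refl _)⟩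

theorem isDOCALanguage_endsLanguage (hf : f ≠ 0) : IsDOCALanguage (endsLanguage op f) := by
  refine ⟨Fin 3, inferInstance, counterDOCA op f, ?_⟩
  ext v
  constructor
  · rintro ⟨q, rfl, n, h⟩
    rcases ends_of_counterDOCA_run op q h rfl with ⟨h, _⟩ | ⟨_, h⟩
    · exact absurd h.symm hf
    · exact h
  · intro h
    obtain ⟨m, h⟩ := Ends.exists_counterDOCA_run h (q := 0) (by decide)
    exact ⟨f, rfl, m, h⟩

/-- Idle operations never fail, so the corresponding automaton accepts an encoding of every
non-empty word. In `validRuns` it plays the part of a universal modality over the separated paths.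
-/
theorem ends_one_of_nop {v : List S} (hv : v ≠ []) (n : ℕ) :
    Ends (fun _ : S => .nop) 1 n v := by
  induction v with
  | nil => exact absurd rfl hv
  | cons a v ih =>
    refine .inl ⟨n, rfl, ?_⟩
    by_cases h : v = []
    · exact .inl ⟨h, rfl⟩
    · exact .inr (ih h)

end ALCSelfVPL

namespace ALCSelfVPL

/-! ## Concepts -/

namespace Concept

/-- The conjunction of a list of concepts. -/
def conj (L : List Concept) : Concept := L.foldr inter top

/-- The disjunction of a list of concepts. -/
def disj (L : List Concept) : Concept := neg (conj (L.map neg))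

theorem mem_extension_conj {Δ : Type} (I : Interpretation Δ) {L : List Concept} {d : Δ} :
    d ∈ I.extension (conj L) ↔ ∀ C ∈ L, d ∈ I.extension C := by
  induction L with
  | nil => simp [conj, Interpretation.extension]
  | cons C L ih =>
    rw [List.forall_mem_cons, ← ih]
    rfl

theorem mem_extension_disj {Δ : Type} (I : Interpretation Δ) {L : List Concept} {d : Δ} :
    d ∈ I.extension (disj L) ↔ ∃ C ∈ L, d ∈ I.extension C := by
  change ¬ d ∈ I.extension (conj _) ↔ _
  simp [mem_extension_conj, Interpretation.extension]

theorem mem_automata_conj {L : List Concept} {A : VPA} :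
    A ∈ (conj L).automata ↔ ∃ C ∈ L, A ∈ C.automata := by
  induction L with
  | nil => simp [conj, automata]
  | cons C L ih =>
    rw [List.exists_mem_cons_iff, ← ih]
    rfl

theorem mem_automata_disj {L : List Concept} {A : VPA} :
    A ∈ (disj L).automata ↔ ∃ C ∈ L, A ∈ C.automata := by
  rw [disj, automata, mem_automata_conj]
  simp [automata]

/-- All roles that stand for a letter are reflexive at the given element. -/
def hasLetter (a : ℕ) : Concept :=
  conj [existsSelf (.call a), existsSelf (.internal a), existsSelf (.ret a)]

theorem mem_extension_hasLetter {Δ : Type} (I : Interpretation Δ) {a : ℕ} {d : Δ} :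
    d ∈ I.extension (hasLetter a) ↔ ∀ e, (d, d) ∈ I.role (decorate (a, e)) := by
  simp only [hasLetter, mem_extension_conj, List.forall_mem_cons, List.not_mem_nil]
  constructor
  · rintro ⟨hc, hi, hr, _⟩ (_ | _ | _)
    exacts [hc, hi, hr]
  · exact fun h => ⟨h .c, h .i, h .r, by simp⟩

variable {S : Finset ℕ} (x : ℕ) (next : S → S → Prop)

open Classical in
/-- There is an `x`-successor, all `x`-successors have letters, and these may follow the letters
of the given element. -/
noncomputable def nextLetters : Concept :=
  conj [existsRole (.internal x) top,
    neg (existsRole (.internal x) (neg (disj (S.toList.map hasLetter)))),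
    conj ((S.attach.toList.product S.attach.toList).map fun p =>
      if next p.1 p.2 then top
      else neg (inter (hasLetter p.1) (existsRole (.internal x) (hasLetter p.2))))]

theorem mem_extension_nextLetters {Δ : Type} (I : Interpretation Δ) {d : Δ} :
    d ∈ I.extension (nextLetters x next) ↔ (∃ e, (d, e) ∈ I.role (.internal x)) ∧
      (∀ e, (d, e) ∈ I.role (.internal x) → ∃ a : S, e ∈ I.extension (hasLetter a)) ∧
      ∀ e, (d, e) ∈ I.role (.internal x) → ∀ a b : S, d ∈ I.extension (hasLetter a) →
        e ∈ I.extension (hasLetter b) → next a b := by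
  simp only [nextLetters, mem_extension_conj, List.forall_mem_cons, List.not_mem_nil]
  refine and_congr ?_ (and_congr ?_ ?_)
  · simp [Interpretation.extension]
  · change ¬ (∃ e, ¬ e ∈ I.extension (disj (S.toList.map hasLetter)) ∧ _) ↔ _
    simp only [mem_extension_disj, List.mem_map, Finset.mem_toList]
    constructor
    · intro h e he
      by_contra hn
      refine h ⟨e, ?_, he⟩
      rintro ⟨_, ⟨a, ha, rfl⟩, hC⟩
      exact hn ⟨⟨a, ha⟩, hC⟩
    · rintro h ⟨e, hn, he⟩
      obtain ⟨a, ha⟩ := h e he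
      exact hn ⟨_, ⟨a.1, a.2, rfl⟩, ha⟩
  · constructor
    · intro h e he a b ha hb
      by_contra hn
      have := h.1 _ (List.mem_map.2 ⟨(a, b), List.mem_product.2 ⟨by simp, by simp⟩, rfl⟩)
      rw [if_neg hn] at this
      exact this ⟨ha, e, hb, he⟩
    · intro h
      refine ⟨fun C hC => ?_, by simp⟩
      obtain ⟨⟨a, b⟩, _, rfl⟩ := List.mem_map.1 hC
      split_ifs with hn
      · trivial
      · rintro ⟨ha, e, hb, he⟩
        exact hn (h e he a b ha hb)

variable (op : ℕ → S → CounterOp) (T : Finset ℕ)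

/-- All elements reached by separated words satisfy `nextLetters`, and no counter in `T` is
operated on in an undefined way along separated words. -/
noncomputable def validRuns : Concept :=
  inter (neg (existsPath (counterVPA x (fun _ : S => .nop) 1) (neg (nextLetters x next))))
    (conj (T.toList.map fun k => neg (existsPath (counterVPA x (op k) 2) top)))

theorem mem_extension_validRuns {Δ : Type} (I : Interpretation Δ) {d : Δ} :
    d ∈ I.extension (validRuns x next op T) ↔
      (∀ v : List S, v ≠ [] → ∀ e, I.WordPath (opWord x (fun _ : S => .nop) v) d e →
        e ∈ I.extension (nextLetters x next)) ∧
      ∀ k ∈ T, ∀ v, Ends (op k) 2 0 v → ∀ e, ¬ I.WordPath (opWord x (op k) v) d e := by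
  refine and_congr ?_ ?_
  · change ¬ (∃ e, ¬ e ∈ I.extension (nextLetters x next) ∧ ∃ w ∈ VPA.language _, _) ↔ _
    constructor
    · intro h v hv e he
      by_contra hn
      exact h ⟨e, hn, _, (mem_counterVPA_language x _ (by decide)).2
        ⟨v, ends_one_of_nop hv 0, rfl⟩, he⟩
    · rintro h ⟨e, hn, w, hw, he⟩
      obtain ⟨v, hv, rfl⟩ := (mem_counterVPA_language x _ (by decide)).1 hw
      exact hn (h v (hv.ne_nil _) e he)
  · rw [mem_extension_conj]
    constructor
    · intro h k hk v hv e he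
      refine h _ (List.mem_map.2 ⟨k, Finset.mem_toList.2 hk, rfl⟩) ⟨e, trivial, _, ?_, he⟩
      exact (mem_counterVPA_language x _ (by decide)).2 ⟨v, hv, rfl⟩
    · intro h C hC
      obtain ⟨k, hk, rfl⟩ := List.mem_map.1 hC
      rintro ⟨e, -, w, hw, he⟩
      obtain ⟨v, hv, rfl⟩ := (mem_counterVPA_language x _ (by decide)).1 hw
      exact h k (Finset.mem_toList.1 hk) v hv e he

/-- There is an `x`-path along `n` elements with the letter `init` and one with `start`. -/
def initialRun (init start : ℕ) : ℕ → Concept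
  | 0 => hasLetter start
  | n + 1 => inter (hasLetter init) (existsRole (.internal x) (initialRun init start n))

/-- The concept that describes the runs on the input `n`. -/
noncomputable def runConcept (init start : S) (n : ℕ) : Concept :=
  inter (initialRun x init start n) (validRuns x next op T)

/-! ### Automata that occur in the concepts -/

theorem automata_hasLetter (a : ℕ) : (hasLetter a).automata = ∅ := by
  simp [hasLetter, conj, automata]

theorem automata_initialRun (init start n : ℕ) : (initialRun x init start n).automata = ∅ := by
  induction n with
  | zero => exact automata_hasLetter _
  | succ n ih => simp [initialRun, automata, automata_hasLetter, ih]

theorem automata_nextLetters : (nextLetters x next).automata = ∅ := by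
  refine Set.eq_empty_iff_forall_notMem.2 fun A hA => ?_
  obtain ⟨C, hC, hA⟩ := mem_automata_conj.1 hA
  simp only [List.mem_cons, List.not_mem_nil, or_false] at hC
  rcases hC with rfl | rfl | rfl
  · exact hA
  · obtain ⟨C, hC, hA⟩ := mem_automata_disj.1 hA
    obtain ⟨a, _, rfl⟩ := List.mem_map.1 hC
    simp [automata_hasLetter] at hA
  · obtain ⟨C, hC, hA⟩ := mem_automata_conj.1 hA
    obtain ⟨p, _, rfl⟩ := List.mem_map.1 hC
    split_ifs at hA
    · exact hA
    · simp [automata, automata_hasLetter] at hA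

theorem onlyDOCAEncodings_runConcept (hx : x ∉ S) (init start : S) (n : ℕ) :
    (runConcept x next op T init start n).OnlyDOCAEncodings := by
  refine ⟨S, x, hx, fun A hA => ?_⟩
  have : ∃ (o : S → CounterOp) (f : Fin 3), f ≠ 0 ∧ A = counterVPA x o f := by
    rcases hA with hA | (rfl | hA) | hA
    · simp [automata_initialRun] at hA
    · exact ⟨_, 1, by decide, rfl⟩
    · change A ∈ (nextLetters x next).automata at hA
      simp [automata_nextLetters] at hA
    · obtain ⟨C, hC, hA⟩ := mem_automata_conj.1 hA
      obtain ⟨k, _, rfl⟩ := List.mem_map.1 hC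
      rcases hA with rfl | hA
      · exact ⟨_, 2, by decide, rfl⟩
      · exact hA.elim
  obtain ⟨o, f, hf, rfl⟩ := this
  exact ⟨_, isDOCALanguage_endsLanguage o hf, encodes_counterVPA x o hf⟩

end Concept

/-! ## From runs to models -/

/-- The interpretation over the natural numbers given by an infinite word. -/
def wordInterpretation {S : Finset ℕ} (x : ℕ) (w : ℕ → S) : Interpretation ℕ where
  individual _ := 0
  concept _ := ∅
  role
    | .call a => {p | p.1 = p.2 ∧ (w p.1).1 = a}
    | .internal a => {p | if a = x then p.2 = p.1 + 1 else p.1 = p.2 ∧ (w p.1).1 = a}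
    | .ret a => {p | p.1 = p.2 ∧ (w p.1).1 = a}

/-- `Follows w i v`: the word `v` consists of the letters of `w` from the position `i` on. -/
def Follows {α : Type} (w : ℕ → α) : ℕ → List α → Prop
  | _, [] => True
  | i, a :: v => a = w i ∧ Follows w (i + 1) v

section Models

variable {S : Finset ℕ} {x : ℕ} {w : ℕ → S}

/-- Internal role names serve both as letters and as the separator; `x ∉ S` keeps the loops of the
former apart from the successor relation of the latter. -/
theorem mem_role_decorate (hx : x ∉ S) (a : S) (e : Decoration) (i j : ℕ) :
    (i, j) ∈ (wordInterpretation x w).role (decorate (a.1, e)) ↔ i = j ∧ w i = a := by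
  have hax : a.1 ≠ x := fun h => hx (h ▸ a.2)
  rw [Subtype.ext_iff]
  cases e
  · rfl
  · change (if a.1 = x then _ else _) ↔ _
    rw [if_neg hax]
  · rfl

theorem mem_role_separator (i j : ℕ) :
    (i, j) ∈ (wordInterpretation x w).role (.internal x) ↔ j = i + 1 := by
  change (if x = x then _ else _) ↔ _
  rw [if_pos rfl]

theorem mem_extension_hasLetter_wordInterpretation (hx : x ∉ S) (a : S) (i : ℕ) :
    i ∈ (wordInterpretation x w).extension (.hasLetter a) ↔ w i = a := by
  simp only [Concept.mem_extension_hasLetter, mem_role_decorate hx, true_and]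
  exact ⟨fun h => h .c, fun h _ => h⟩

theorem follows_of_wordPath (hx : x ∉ S) (o : S → CounterOp) {v : List S} {i j : ℕ}
    (h : (wordInterpretation x w).WordPath (opWord x o v) i j) : Follows w i v := by
  induction v generalizing i with
  | nil => trivial
  | cons a v ih =>
    cases v with
    | nil =>
      obtain ⟨i', hi, _⟩ := h
      exact ⟨((mem_role_decorate hx a _ i i').1 hi).2.symm, trivial⟩
    | cons b v =>
      rw [opWord_cons x o a (List.cons_ne_nil _ _)] at h
      obtain ⟨i', hi, i'', hi', h⟩ := h
      obtain ⟨rfl, hw⟩ := (mem_role_decorate hx a _ i i').1 hi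
      obtain rfl := (mem_role_separator (w := w) i i'').1 hi'
      exact ⟨hw.symm, ih h⟩

/-- `Ends` with `2` requires an undefined operation at the last letter, but along `w` the counter
values `c` witness that all operations are defined. -/
theorem not_ends_of_follows {o : S → CounterOp} {c : ℕ → ℕ}
    (hc : ∀ i, (o (w i)).eff (c i) = some (c (i + 1))) {v : List S} {i : ℕ}
    (h : Follows w i v) : ¬ Ends o 2 (c i) v := by
  induction v generalizing i with
  | nil => exact id
  | cons a v ih =>
    obtain ⟨rfl, h⟩ := h
    rintro (⟨m, hm, ⟨_, h2⟩ | h2⟩ | ⟨hm, _⟩)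
    · exact absurd h2 (by decide)
    · rw [hc] at hm
      obtain rfl := Option.some.inj hm
      exact ih h h2
    · simp [hc] at hm

theorem HasRun.satisfiable {next : S → S → Prop} {op : ℕ → S → CounterOp} {init start : S}
    {n : ℕ} (h : HasRun next op init start n) (hx : x ∉ S) (T : Finset ℕ) :
    (Concept.runConcept x next op T init start n).Satisfiable := by
  obtain ⟨w, c, hinit, hstart, hnext, hc0, hc⟩ := h
  refine ⟨ℕ, ⟨0⟩, wordInterpretation x w, 0, ?_, ?_⟩
  · have : ∀ m ≤ n, n - m ∈ (wordInterpretation x w).extension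
        (Concept.initialRun x init start m) := by
      intro m hm
      induction m with
      | zero => exact (mem_extension_hasLetter_wordInterpretation hx _ _).2 hstart
      | succ m ih =>
        refine ⟨(mem_extension_hasLetter_wordInterpretation hx _ _).2 (hinit _ (by omega)),
          n - m, ih (by omega), ?_⟩
        rw [mem_role_separator]
        omega
    simpa using this n le_rfl
  · rw [Concept.mem_extension_validRuns]
    constructor
    · intro _ _ e _
      rw [Concept.mem_extension_nextLetters]
      simp only [mem_role_separator, mem_extension_hasLetter_wordInterpretation hx]
      refine ⟨⟨_, rfl⟩, fun e _ => ⟨_, rfl⟩, ?_⟩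
      rintro _ rfl _ _ rfl rfl
      exact hnext e
    · intro k _ v hv e he
      refine not_ends_of_follows (c := fun i => c i k) (fun i => hc i k)
        (follows_of_wordPath hx _ he) ?_
      simpa [hc0] using hv

end Models

/-! ## From models to runs -/

namespace Interpretation

variable {Δ : Type} (I : Interpretation Δ)

theorem wordPath_append {u v : List Letter} {d e : Δ} :
    I.WordPath (u ++ v) d e ↔ ∃ d', I.WordPath u d d' ∧ I.WordPath v d' e := by
  induction u generalizing d with
  | nil => simp [WordPath]
  | cons a u ih =>
    simp only [List.cons_append, WordPath, ih]
    constructor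
    · rintro ⟨d₁, h₁, d₂, h₂, h₃⟩
      exact ⟨d₂, ⟨d₁, h₁, h₂⟩, h₃⟩
    · rintro ⟨d₂, ⟨d₁, h₁, h₂⟩, h₃⟩
      exact ⟨d₁, h₁, d₂, h₂, h₃⟩

end Interpretation

/-- The `l` letters of an infinite word from the position `i` on. -/
def segment {α : Type} (w : ℕ → α) : ℕ → ℕ → List α
  | _, 0 => []
  | i, l + 1 => w i :: segment w (i + 1) l

/-- An infinite path along elements with letters. -/
structure IsLetterPath {Δ : Type} {S : Finset ℕ} (I : Interpretation Δ) (x : ℕ)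
    (next : S → S → Prop) (δ : ℕ → Δ) (w : ℕ → S) : Prop where
  letter : ∀ i, δ i ∈ I.extension (.hasLetter (w i))
  edge : ∀ i, (δ i, δ (i + 1)) ∈ I.role (.internal x)
  next : ∀ i, next (w i) (w (i + 1))

section Runs

variable {Δ : Type} {S : Finset ℕ} {I : Interpretation Δ} {x : ℕ} {next : S → S → Prop}
  {δ : ℕ → Δ} {w : ℕ → S}

theorem letterStep_of_hasLetter {d : Δ} {a : ℕ} (h : d ∈ I.extension (.hasLetter a))
    (e : Decoration) : I.LetterStep (.role (decorate (a, e))) d d :=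
  (Concept.mem_extension_hasLetter I).1 h e

/-- This is where `Self` acts: the loops exist under all three decorations, so `o` is arbitrary and
the automata of all counters read one and the same path. -/
theorem IsLetterPath.wordPath (h : IsLetterPath I x next δ w) (o : S → CounterOp) (i l : ℕ) :
    I.WordPath (opWord x o (segment w i (l + 1))) (δ i) (δ (i + l)) := by
  induction l generalizing i with
  | zero => exact ⟨δ i, letterStep_of_hasLetter (h.letter i) _, rfl⟩
  | succ l ih =>
    rw [segment, opWord_cons x o _ (show segment w (i + 1) (l + 1) ≠ [] from List.cons_ne_nil _ _)]
    refine ⟨δ i, letterStep_of_hasLetter (h.letter i) _, δ (i + 1), h.edge i, ?_⟩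
    rw [show i + (l + 1) = i + 1 + l by omega]
    exact ih (i + 1)

theorem ends_segment {o : S → CounterOp} {c : ℕ → ℕ} {i l : ℕ}
    (hc : ∀ j < l, (o (w (i + j))).eff (c (i + j)) = some (c (i + j + 1)))
    (hl : (o (w (i + l))).eff (c (i + l)) = none) :
    Ends o 2 (c i) (segment w i (l + 1)) := by
  induction l generalizing i with
  | zero => exact .inr ⟨hl, rfl, rfl⟩
  | succ l ih =>
    refine .inl ⟨c (i + 1), hc 0 (by omega), .inr (ih (fun j hj => ?_) ?_)⟩
    · rw [show i + 1 + j = i + (j + 1) by omega]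
      exact hc (j + 1) (by omega)
    · rw [show i + 1 + l = i + (l + 1) by omega]
      exact hl

/-- The value of a counter after each operation, or `0` from the first undefined one on. -/
def counterValue (o : S → CounterOp) (w : ℕ → S) : ℕ → ℕ
  | 0 => 0
  | i + 1 => ((o (w i)).eff (counterValue o w i)).getD 0

/-- At the first undefined operation, the initial segment up to and including its letter would be
one of the forbidden words. Hence the default value `0` in `counterValue` is never used. -/
theorem eff_counterValue {o : S → CounterOp} (h : ∀ l, ¬ Ends o 2 0 (segment w 0 (l + 1)))
    (i : ℕ) : (o (w i)).eff (counterValue o w i) = some (counterValue o w (i + 1)) := by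
  induction i using Nat.strong_induction_on with
  | _ i ih =>
    cases he : (o (w i)).eff (counterValue o w i) with
    | none =>
      refine absurd (ends_segment (i := 0) (l := i) (c := counterValue o w) ?_ ?_) (h i)
      · simpa using ih
      · simpa using he
    | some m => simp [counterValue, he]

variable (I x S) in
/-- `e` is reached from `d` by a separated word. -/
def SeparatedReach (d e : Δ) : Prop :=
  ∃ v : List S, v ≠ [] ∧ I.WordPath (opWord x (fun _ : S => .nop) v) d e

theorem SeparatedReach.step {d e e' : Δ} {b : S} (h : SeparatedReach S I x d e)
    (he : (e, e') ∈ I.role (.internal x)) (hb : e' ∈ I.extension (.hasLetter b)) :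
    SeparatedReach S I x d e' := by
  obtain ⟨v, hv, h⟩ := h
  refine ⟨v ++ [b], by simp, ?_⟩
  rw [opWord, List.map_append, List.map_singleton, separatedWord_concat x (by simpa using hv),
    I.wordPath_append]
  exact ⟨e, h, e', he, e', letterStep_of_hasLetter hb _, rfl⟩

/-- Dependent choice over pairs of a reachable element and one of its letters. An element may carry
several letters, but `nextLetters` constrains every pair of letters of neighbours, so any choice is
admissible. -/
theorem exists_isLetterPath {r : Δ}
    (hr : ∀ e, SeparatedReach S I x r e → e ∈ I.extension (.nextLetters x next))
    {d : Δ} (hd : SeparatedReach S I x r d) {a : S} (ha : d ∈ I.extension (.hasLetter a)) :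
    ∃ δ w, IsLetterPath I x next δ w ∧ δ 0 = d ∧ w 0 = a := by
  let G := {p : Δ × S // SeparatedReach S I x r p.1 ∧ p.1 ∈ I.extension (.hasLetter p.2)}
  have hstep : ∀ p : G, ∃ q : G, (p.1.1, q.1.1) ∈ I.role (.internal x) ∧ next p.1.2 q.1.2 := by
    rintro ⟨⟨e, b⟩, he, hb⟩
    obtain ⟨⟨e', hee'⟩, h2, h3⟩ := (Concept.mem_extension_nextLetters x next I).1 (hr e he)
    obtain ⟨b', hb'⟩ := h2 e' hee'
    exact ⟨⟨(e', b'), he.step hee' hb', hb'⟩, hee', h3 e' hee' b b' hb hb'⟩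
  choose g hg hg' using hstep
  let t : ℕ → G := fun i => g^[i] ⟨(d, a), hd, ha⟩
  have ht : ∀ i, t (i + 1) = g (t i) := fun i => Function.iterate_succ_apply' _ _ _
  exact ⟨fun i => (t i).1.1, fun i => (t i).1.2, ⟨fun i => (t i).2.2,
    fun i => by rw [ht]; exact hg _, fun i => by rw [ht]; exact hg' _⟩, rfl, rfl⟩

/-- The prescribed initial elements must come first on the path, so they are prepended to a path
obtained by choice. Reachability of `d` is assumed only if `d` has a letter, since a separated word
ends with a letter. -/
theorem exists_isLetterPath_of_initialRun {r : Δ}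
    (hr : ∀ e, SeparatedReach S I x r e → e ∈ I.extension (.nextLetters x next))
    {init start : S} {n : ℕ} {d : Δ}
    (hd : (∃ a : S, d ∈ I.extension (.hasLetter a)) → SeparatedReach S I x r d)
    (hn : d ∈ I.extension (.initialRun x init start n)) :
    ∃ δ w, IsLetterPath I x next δ w ∧ δ 0 = d ∧ (∀ i < n, w i = init) ∧ w n = start := by
  induction n generalizing d with
  | zero =>
    obtain ⟨δ, w, h, h0, h0'⟩ := exists_isLetterPath hr (hd ⟨start, hn⟩) hn
    exact ⟨δ, w, h, h0, by simp, h0'⟩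
  | succ n ih =>
    obtain ⟨hi, e, he, hde⟩ := hn
    have hd := hd ⟨init, hi⟩
    obtain ⟨δ, w, h, rfl, h1, h2⟩ := ih (fun ⟨_, hb⟩ => hd.step hde hb) he
    refine ⟨fun i => Nat.casesOn i d δ, fun i => Nat.casesOn i init w, ⟨?_, ?_, ?_⟩, rfl, ?_, h2⟩
    · rintro (_ | i)
      exacts [hi, h.letter i]
    · rintro (_ | i)
      exacts [hde, h.edge i]
    · rintro (_ | i)
      · exact ((Concept.mem_extension_nextLetters x next I).1 (hr d hd)).2.2 _ hde _ _ hi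
          (h.letter 0)
      · exact h.next i
    · rintro (_ | i) hi
      · rfl
      · exact h1 i (by omega)

theorem hasRun_of_satisfiable {op : ℕ → S → CounterOp} {init start : S} {n : ℕ} {T : Finset ℕ}
    (hT : ∀ k ∉ T, ∀ a, op k a = .nop)
    (h : (Concept.runConcept x next op T init start n).Satisfiable) :
    HasRun next op init start n := by
  obtain ⟨Δ, _, I, r, hn, hv⟩ := h
  rw [Concept.mem_extension_validRuns] at hv
  obtain ⟨δ, w, h, rfl, h1, h2⟩ := exists_isLetterPath_of_initialRun (next := next)
    (fun e ⟨v, hv', he⟩ => hv.1 v hv' e he)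
    -- The root reaches itself by the loop of its own letter.
    (fun ⟨a, ha⟩ => ⟨[a], by simp, r, letterStep_of_hasLetter ha _, rfl⟩) hn
  refine ⟨w, fun i k => counterValue (op k) w i, h1, h2, h.next, rfl, fun i k => ?_⟩
  by_cases hk : k ∈ T
  · refine eff_counterValue (fun l hl => hv.2 k hk _ hl _ (h.wordPath _ 0 l)) i
  · simp [counterValue, hT k hk, CounterOp.eff]

end Runs

/-! ## Computability -/

open Encodable

/-- Only `initialRun` depends on `n`, and its Gödel number arises by primitive recursion. The code
of `validRuns` is one constant, so the classical choices in its definition do no harm. -/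
theorem computable_runConcept {S : Finset ℕ} (x : ℕ) (next : S → S → Prop)
    (op : ℕ → S → CounterOp) (T : Finset ℕ) (init start : S) :
    Computable (Concept.runConcept x next op T init start) := by
  apply Primrec.to_comp
  rw [← Primrec.encode_iff]
  have hpair : ∀ k m : ℕ, ∀ f g : ℕ → ℕ, Primrec f → Primrec g →
      Primrec fun n => m * Nat.pair (f n) (g n) + k := fun k m f g hf hg =>
    Primrec.nat_add.comp (Primrec.nat_mul.comp (.const m) (Primrec₂.natPair.comp hf hg)) (.const k)
  have h : Primrec fun n => (Concept.initialRun x init start n).toCode := by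
    refine (Primrec.nat_rec₁ (Concept.hasLetter start).toCode (f := fun _ c =>
      -- The numbers mirror `toCode`: summand `4` for `inter` and `5` for `existsRole`.
      6 * Nat.pair (Concept.hasLetter init).toCode
        (6 * Nat.pair (encode (RoleName.internal x)) c + 5) + 4)
      (Primrec.comp (f := fun c => 6 * Nat.pair (Concept.hasLetter init).toCode
        (6 * Nat.pair (encode (RoleName.internal x)) c + 5) + 4)
        (hpair 4 6 _ _ (.const _) (hpair 5 6 _ _ (.const _) .id)) Primrec.snd)).of_eq fun n => ?_
    induction n with
    | zero => rfl
    | succ n ih => simp only [ih, Concept.initialRun, Concept.toCode]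
  exact hpair 4 6 _ _ h (.const _)

theorem not_exists_computablePred_iff_satisfiable :
    ¬ ∃ P : Concept → Prop, ComputablePred P ∧
      ∀ C : Concept, C.OnlyDOCAEncodings → (P C ↔ C.Satisfiable) := by
  rintro ⟨P, hP, h⟩
  -- The domain of `f` is the halting set, so one program and one alphabet serve for all instances,
  -- and only the input `n` varies.
  let f : ℕ →. ℕ := fun n => (Denumerable.ofNat Nat.Partrec.Code n).eval 0
  have hf : Partrec f :=
    Nat.Partrec.Code.eval_part.comp (Computable.ofNat Nat.Partrec.Code) (Computable.const 0)
  obtain ⟨S, T, next, op, init, start, hT, hrun⟩ := exists_hasRun_iff_not_dom hf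
  obtain ⟨x, hx⟩ := Infinite.exists_notMem_finset S
  have hiff : ∀ n, P (Concept.runConcept x next op T init start n) ↔ ¬ (f n).Dom := fun n => by
    rw [h _ (Concept.onlyDOCAEncodings_runConcept x next op T hx init start n), ← hrun]
    exact ⟨hasRun_of_satisfiable hT, fun h => h.satisfiable hx T⟩
  refine ComputablePred.halting_problem 0 ?_
  obtain ⟨_, hP⟩ := hP
  have hc := (hP.comp ((computable_runConcept x next op T init start).comp
    (Computable.encode (α := Nat.Partrec.Code))))
  refine (ComputablePred.not (p := fun c : Nat.Partrec.Code =>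
    P (Concept.runConcept x next op T init start (encode c))) ⟨inferInstance, hc⟩).of_eq
    fun c => ?_
  rw [hiff, not_not]
  simp [f]

end ALCSelfVPL

theorem mainTheorem2 :
    ¬ ComputablePred ALCSelfVPL.Concept.Satisfiable ∧
      ¬ ∃ P : ALCSelfVPL.Concept → Prop, ComputablePred P ∧
        ∀ C : ALCSelfVPL.Concept, C.OnlyDOCAEncodings → (P C ↔ C.Satisfiable) :=
  ⟨fun h => ALCSelfVPL.not_exists_computablePred_iff_satisfiable ⟨_, h, fun _ _ => Iff.rfl⟩,
    ALCSelfVPL.not_exists_computablePred_iff_satisfiable⟩
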